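/- Let $\Bbbk$ be an algebraically closed field of characteristic zero and let $G$ be a finite group. Let $F(G)$ be the algebra of $\Bbbk$-valued functions on $G$, with basis $\delta_h$ ($h\in G$). Let $\mathcal D(G)=\Bbbk[G]\otimes F(G)$ be the Drinfeld double, with product $$(g\otimes\delta_h)(g'\otimes\delta_{h'})=gg'\otimes\delta_{g'^{-1}hg'}\,\delta_{h'} .$$ For a finite-dimensional $\mathcal D(G)$-module $V$ put $V_g=\delta_gV$, so that $V=\bigoplus_{g\in G}V_g$. The category $\mathcal D(G)\text{-mod}$ of finite-dimensional modules is monoidal under the fibrewise tensor product $\overline\otimes$, given by $(V\,\overline\otimes\,W)_g=V_g\otimes_{\Bbbk}W_g$ with $G$ acting diagonally (its unit is $\bigoplus_{g\in G}\Bbbk_g$, with $(\overline{\mathbf 1})_g=\Bbbk$ for all $g$). Let $\mathcal D^{\mathrm{el}}(G)=\Bbbk[G]\otimes F(G)\otimes F(G)$ be the elliptic double, with product $$(g\otimes\delta_{h_1}\otimes\delta_{h_2})(g'\otimes\delta_{h_1'}\otimes\delta_{h_2'})=gg'\otimes\delta_{g'^{-1}h_1g'}\,\delta_{h_1'}\otimes\delta_{g'^{-1}h_2g'}\,\delta_{h_2'}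 .$$ Let $\Omega=\{(h,h')\in G\times G : hh'=h'h\}$, on which $G$ acts by simultaneous conjugation, let $\delta_\Omega=\sum_{(h,h')\in\Omega}1\otimes\delta_h\otimes\delta_{h'}$, a central idempotent, and let $\mathcal D_{\mathbf T^2}(G)=\mathcal D^{\mathrm{el}}(G)\cdot\delta_\Omega$, an algebra with unit $\delta_\Omega$. Then there is an equivalence of $\Bbbk$-linear abelian categories $$\mathcal Z\big((\mathcal D(G)\text{-mod},\overline\otimes)\big)\;\simeq\;\mathcal D_{\mathbf T^2}(G)\text{-mod}$$ between the Drinfeld center of $(\mathcal D(G)\text{-mod},\overline\otimes)$ and the category of finite-dimensional $\mathcal D_{\mathbf T^2}(G)$-modules. Moreover $\mathcal D_{\mathbf T^2}(G)\text{-mod}$ is equivalent, as a $\Bbbk$-linear category, to the category of $G$-equivariant bundles of finite-dimensional vector spaces over $\Omega$. -/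

import Mathlib

open CategoryTheory MonoidalCategory

universe u

set_option linter.unusedSectionVars false

noncomputable section

/-! ## Linear structure on the Drinfeld center, abelian categories -/

namespace CategoryTheory

namespace Center

variable {C : Type*} [Category* C] [Preadditive C] [MonoidalCategory C] [MonoidalPreadditive C]

/-- Morphisms of the Drinfeld center form an additive subgroup of the morphisms of `C`. -/
def homAddSubgroup (A B : Center C) : AddSubgroup (A.1 ⟶ B.1) where
  carrier := {f | ∀ U, (f ▷ U) ≫ (B.2.β U).hom = (A.2.β U).hom ≫ (U ◁ f)}
  zero_mem' U := by simp
  add_mem' {f g} hf hg U := by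
    simp only [Set.mem_ofPred_eq] at hf hg
    simp [hf U, hg U]
  neg_mem' {f} hf U := by
    simp only [Set.mem_ofPred_eq] at hf
    have h1 : (-f) ▷ U = -(f ▷ U) := (tensorRight U).map_neg
    have h2 : U ◁ (-f) = -(U ◁ f) := (tensorLeft U).map_neg
    simp [h1, h2, hf U]

/-- The bundled and unbundled descriptions of morphisms of the center. -/
def homEquiv (A B : Center C) : (A ⟶ B) ≃ homAddSubgroup A B where
  toFun f := ⟨f.f, f.comm⟩
  invFun f := { f := f.1, comm := f.2 }
  left_inv _ := rfl
  right_inv _ := rfl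

/-- The preadditive structure of the Drinfeld center: morphisms are added in `C`. -/
instance instPreadditiveCenter : Preadditive (Center C) where
  homGroup A B := (homEquiv A B).addCommGroup
  add_comp _ _ _ f g h := Center.ext _ _ (Preadditive.add_comp _ _ _ f.f g.f h.f)
  comp_add _ _ _ f g h := Center.ext _ _ (Preadditive.comp_add _ _ _ f.f g.f h.f)

variable {k : Type*} [Semiring k] [Linear k C] [MonoidalLinear k C]

/-- Morphisms of the Drinfeld center form a linear subspace of the morphisms of `C`. -/
def homSubmodule (A B : Center C) : Submodule k (A.1 ⟶ B.1) where
  __ := (homAddSubgroup A B).toAddSubmonoid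
  smul_mem' r f hf U := by
    have hf' : (f ▷ U) ≫ (B.2.β U).hom = (A.2.β U).hom ≫ (U ◁ f) := hf U
    simp [hf']

/-- The linear structure of the Drinfeld center: morphisms are scaled in `C`. -/
instance instLinearCenter : Linear k (Center C) where
  homModule A B :=
    letI e : (A ⟶ B) ≃+ homSubmodule (k := k) A B :=
      { toFun := fun f => ⟨f.f, f.comm⟩
        invFun := fun f => { f := f.1, comm := f.2 }
        left_inv := fun _ => rfl
        right_inv := fun _ => rfl
        map_add' := fun _ _ => rfl }
    e.module k
  smul_comp _ _ _ r f g := Center.ext _ _ (Linear.smul_comp _ _ _ r f.f g.f)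
  comp_smul _ _ _ f r g := Center.ext _ _ (Linear.comp_smul _ _ _ f.f r g.f)

end Center

/-- A preadditive category is abelian (with its given addition of morphisms). -/
def IsAbelianCategory (C : Type*) [Category* C] [P : Preadditive C] : Prop :=
  ∃ A : Abelian C, A.toPreadditive = P

end CategoryTheory

/-! ## The action algebra of a finite group acting on a set -/

/-- For a finite group `H` acting on a set `X`, the algebra `k[H] ⊗ F(X)`.
The function `a : H → X → k` stands for `∑ a h x • (h ⊗ δ_x)`, so that for finite `X` the elements
`h ⊗ δ_x` (see `ActionAlgebra.single`) form a basis; the product is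
`(h ⊗ δ_x) (h' ⊗ δ_x') = h h' ⊗ δ_{h'⁻¹ x} δ_x'` (see `ActionAlgebra.single_mul_single`). -/
def ActionAlgebra (k H X : Type*) := H → X → k

/-- The element of the action algebra with the given coefficients. -/
def ActionAlgebra.mk {k H X : Type*} (a : H → X → k) : ActionAlgebra k H X := a

namespace ActionAlgebra

variable {k H X : Type*} [Field k] [Group H] [Fintype H] [MulAction H X]

instance instAddCommGroup : AddCommGroup (ActionAlgebra k H X) := inferInstanceAs (AddCommGroup (H → X → k))
instance instModule : Module k (ActionAlgebra k H X) := inferInstanceAs (Module k (H → X → k))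

instance instFunLike : FunLike (ActionAlgebra k H X) H (X → k) where
  coe a := a
  coe_injective _ _ h := h

@[ext] theorem ext {a b : ActionAlgebra k H X} (h : ∀ g x, a g x = b g x) : a = b :=
  DFunLike.coe_injective (funext fun g => funext fun x => h g x)

@[simp] theorem add_apply (a b : ActionAlgebra k H X) (g : H) (x : X) :
    (a + b) g x = a g x + b g x := rfl
@[simp] theorem zero_apply (g : H) (x : X) : (0 : ActionAlgebra k H X) g x = 0 := rfl
@[simp] theorem smul_apply (r : k) (a : ActionAlgebra k H X) (g : H) (x : X) :
    (r • a) g x = r * a g x := rfl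

theorem sum_apply {ι : Type*} (s : Finset ι) (a : ι → ActionAlgebra k H X) (g : H) (x : X) :
    (∑ i ∈ s, a i) g x = ∑ i ∈ s, a i g x :=
  map_sum (AddMonoidHom.mk' (fun b : ActionAlgebra k H X => b g x) fun _ _ => rfl) a s

instance instMul : Mul (ActionAlgebra k H X) where
  mul a b := .mk fun g x => ∑ h : H, a (g * h⁻¹) (h • x) * b h x

theorem mul_apply (a b : ActionAlgebra k H X) (g : H) (x : X) :
    (a * b) g x = ∑ h : H, a (g * h⁻¹) (h • x) * b h x := rfl

open Classical in
/-- The element `e ⊗ f` for a function `f` on `X`. -/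
def ofFun (f : X → k) : ActionAlgebra k H X := .mk fun g x => if g = 1 then f x else 0


open Classical in
theorem ofFun_apply (f : X → k) (g : H) (x : X) :
    (ofFun f : ActionAlgebra k H X) g x = if g = 1 then f x else 0 := rfl

theorem ofFun_mul (f : X → k) (a : ActionAlgebra k H X) (g : H) (x : X) :
    (ofFun f * a : ActionAlgebra k H X) g x = f (g • x) * a g x := by
  classical
  rw [mul_apply, Finset.sum_eq_single g]
  · simp [ofFun_apply]
  · intro h _ hne
    have : g * h⁻¹ ≠ 1 := fun h1 => hne (mul_inv_eq_one.mp h1).symm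
    simp [ofFun_apply, this]
  · simp

theorem mul_ofFun (f : X → k) (a : ActionAlgebra k H X) (g : H) (x : X) :
    (a * ofFun f : ActionAlgebra k H X) g x = a g x * f x := by
  classical
  rw [mul_apply, Finset.sum_eq_single 1]
  · simp [ofFun_apply]
  · intro h _ hne
    simp [ofFun_apply, hne]
  · simp

/-- The unit is `e ⊗ δ_*`, where `δ_*` is the constant function `1`. -/
instance instOne : One (ActionAlgebra k H X) := ⟨ofFun fun _ => 1⟩

theorem one_def : (1 : ActionAlgebra k H X) = ofFun fun _ => 1 := rfl

instance instRing : Ring (ActionAlgebra k H X) where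
  __ := (inferInstance : AddCommGroup (ActionAlgebra k H X))
  mul := (· * ·)
  one := 1
  one_mul a := by ext g x; rw [one_def, ofFun_mul, one_mul]
  mul_one a := by ext g x; rw [one_def, mul_ofFun, mul_one]
  zero_mul a := by ext g x; simp [mul_apply]
  mul_zero a := by ext g x; simp [mul_apply]
  left_distrib a b c := by ext g x; simp [mul_apply, mul_add, Finset.sum_add_distrib]
  right_distrib a b c := by ext g x; simp [mul_apply, add_mul, Finset.sum_add_distrib]
  mul_assoc a b c := by
    ext g x
    simp only [mul_apply, Finset.sum_mul, Finset.mul_sum]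
    conv_rhs => rw [Finset.sum_comm]
    refine Finset.sum_congr rfl fun l _ => ?_
    conv_rhs => rw [← Equiv.sum_comp (Equiv.mulRight l)]
    refine Finset.sum_congr rfl fun m _ => ?_
    simp [mul_smul, mul_assoc]

instance instAlgebra : Algebra k (ActionAlgebra k H X) :=
  Algebra.ofModule
    (fun r a b => by ext g x; simp [mul_apply, Finset.mul_sum, mul_assoc])
    (fun r a b => by ext g x; simp [mul_apply, Finset.mul_sum, mul_left_comm])

open Classical in
/-- The basis element `h ⊗ δ_x`. -/
def single (h : H) (x : X) : ActionAlgebra k H X := .mk fun g y => if g = h ∧ y = x then 1 else 0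

open Classical in
theorem single_apply (h : H) (x : X) (g : H) (y : X) :
    (single h x : ActionAlgebra k H X) g y = if g = h ∧ y = x then 1 else 0 := rfl

open Classical in
/-- The product of basis elements: `(h ⊗ δ_x) (h' ⊗ δ_x') = h h' ⊗ δ_{h'⁻¹ x} δ_x'`. -/
theorem single_mul_single (h h' : H) (x x' : X) :
    (single h x * single h' x' : ActionAlgebra k H X) =
      if h'⁻¹ • x = x' then single (h * h') x' else 0 := by
  ext g y
  rw [mul_apply, Finset.sum_eq_single h']
  · by_cases hy : y = x'
    · subst hy
      by_cases hx : h'⁻¹ • x = y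
      · subst hx
        simp [single_apply, mul_inv_eq_iff_eq_mul]
      · have : ¬ (h' • y = x) := fun e => hx (by rw [← e, inv_smul_smul])
        simp [single_apply, hx, this]
    · split_ifs <;> simp [single_apply, hy]
  · intro l _ hl
    simp [single_apply, hl]
  · simp

theorem smul_single_smul {V : Type*} [AddCommGroup V] [Module (ActionAlgebra k H X) V]
    (h h' : H) (x y : X) (hy : h' • x = y) (v : V) :
    (single h y : ActionAlgebra k H X) • (single h' x : ActionAlgebra k H X) • v =
      (single (h * h') x : ActionAlgebra k H X) • v := by
  rw [smul_smul, single_mul_single, if_pos (by rw [← hy, inv_smul_smul])]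

theorem single_one_smul_of_ne {V : Type*} [AddCommGroup V] [Module (ActionAlgebra k H X) V]
    (h : H) (x y : X) (hy : y ≠ x) (v : V) :
    (single h y : ActionAlgebra k H X) • (single 1 x : ActionAlgebra k H X) • v = 0 := by
  rw [smul_smul, single_mul_single, if_neg (by simpa using hy), zero_smul]

theorem sum_single_one [Fintype X] : ∑ x, (single 1 x : ActionAlgebra k H X) = 1 := by
  classical
  ext g y
  rw [sum_apply]
  by_cases hg : g = 1 <;> simp [single_apply, one_def, ofFun_apply, hg]

theorem eq_sum_single [Fintype X] (a : ActionAlgebra k H X) :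
    a = ∑ h, ∑ x, a h x • single h x := by
  classical
  ext g y
  simp only [sum_apply]
  rw [Finset.sum_eq_single g, Finset.sum_eq_single y]
  · simp [single_apply]
  · intro z _ hz; simp [single_apply, hz.symm]
  · simp
  · intro z _ hz; simp [single_apply, hz.symm]
  · simp

instance instFinite [Finite X] : Module.Finite k (ActionAlgebra k H X) :=
  inferInstanceAs (Module.Finite k (H → X → k))

instance instIsNoetherianRing [Finite X] : IsNoetherianRing (ActionAlgebra k H X) :=
  IsNoetherianRing.of_finite k _

end ActionAlgebra

/-! ## Equivariant bundles and modules over the action algebra -/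

/-- The category of `H`-equivariant bundles of finite-dimensional vector spaces over an `H`-set `X`:
families of vector spaces `B x` with isomorphisms `B x ≅ B (h • x)`, compatible with the product
of `H`, that is, functors on the action groupoid, whose objects are the points of `X` and whose
morphisms `x ⟶ y` are the `h` in `H` with `h • x = y`. It carries the fibrewise tensor product. -/
abbrev EquivariantBundle (k H X : Type u) [Field k] [Group H] [MulAction H X] :=
  ActionCategory H X ⥤ FGModuleCat.{u} k

namespace ActionAlgebra

open scoped ModuleCat

/-- The point `x`, as an object of the action groupoid. -/
def pt (H : Type u) {X : Type u} [Group H] [MulAction H X] (x : X) : ActionCategory H X :=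
  ActionCategory.objEquiv H X x

/-- The morphism from `x` to `y = h • x` in the action groupoid. -/
def arrow {H X : Type u} [Group H] [MulAction H X] (h : H) {x y : X} (hy : h • x = y) :
    pt H x ⟶ pt H y := ⟨h, hy⟩

/-- The group element of a morphism in the action groupoid. -/
def label {H X : Type u} [Group H] [MulAction H X] {p q : ActionCategory H X} (f : p ⟶ q) : H := f.1

theorem label_smul {H X : Type u} [Group H] [MulAction H X] {p q : ActionCategory H X}
    (f : p ⟶ q) : label f • p.back = q.back := f.2

variable {k H X : Type u} [Field k] [Group H] [Fintype H] [MulAction H X]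

theorem smul_comm_scalar (V : FGModuleCat.{u} (ActionAlgebra k H X)) (a : ActionAlgebra k H X)
    (r : k) (v : V) : a • r • v = r • a • v := by
  have h : ∀ w : V, r • w = (algebraMap k (ActionAlgebra k H X) r) • w := fun w => rfl
  rw [h, h, smul_smul, smul_smul, Algebra.commutes]

/-- The fibre `V_x = δ_x V` of a module `V` over the action algebra. -/
def fiber (V : FGModuleCat.{u} (ActionAlgebra k H X)) (x : X) : Submodule k V where
  carrier := {v | (single 1 x : ActionAlgebra k H X) • v = v}
  zero_mem' := smul_zero _
  add_mem' {v w} hv hw := (smul_add _ v w).trans (congrArg₂ _ hv hw)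
  smul_mem' r v hv := (smul_comm_scalar V _ r v).trans (congrArg _ hv)

theorem mem_fiber {V : FGModuleCat.{u} (ActionAlgebra k H X)} {x : X} {v : V} :
    v ∈ fiber V x ↔ (single 1 x : ActionAlgebra k H X) • v = v := Iff.rfl

theorem single_smul_mem (V : FGModuleCat.{u} (ActionAlgebra k H X)) {h : H} {x y : X}
    (hy : h • x = y) (v : V) : (single h x : ActionAlgebra k H X) • v ∈ fiber V y := by
  rw [mem_fiber, smul_single_smul _ _ _ _ hy, one_mul]

theorem single_smul_of_mem {V : FGModuleCat.{u} (ActionAlgebra k H X)} {x : X} {v : V}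
    (hv : v ∈ fiber V x) (h : H) {y : X} (hy : y ≠ x) :
    (single h y : ActionAlgebra k H X) • v = 0 := by
  rw [← mem_fiber.1 hv, single_one_smul_of_ne _ _ _ hy]

theorem finite_scalar [Finite X] (V : FGModuleCat.{u} (ActionAlgebra k H X)) :
    Module.Finite k V := Module.Finite.trans (ActionAlgebra k H X) V

instance instFiniteFiber [Finite X] (V : FGModuleCat.{u} (ActionAlgebra k H X)) (x : X) :
    Module.Finite k (fiber V x) :=
  have := finite_scalar V
  inferInstance

/-- The action `v ↦ h v` from the fibre over `x` to the fibre over `h • x`. -/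
def fiberMap (V : FGModuleCat.{u} (ActionAlgebra k H X)) (h : H) {x y : X} (hy : h • x = y) :
    fiber V x →ₗ[k] fiber V y where
  toFun v := ⟨(single h x : ActionAlgebra k H X) • v.1, single_smul_mem V hy _⟩
  map_add' v w := Subtype.ext (smul_add _ v.1 w.1)
  map_smul' r v := Subtype.ext (smul_comm_scalar V _ r v.1)

/-- A morphism of modules preserves the fibres. -/
def fiberHom {V W : FGModuleCat.{u} (ActionAlgebra k H X)} (f : V ⟶ W) (x : X) :
    fiber V x →ₗ[k] fiber W x where
  toFun v := ⟨f.hom.hom v.1, by rw [mem_fiber, ← map_smul, mem_fiber.1 v.2]⟩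
  map_add' v w := Subtype.ext (map_add f.hom.hom v.1 w.1)
  map_smul' r v := Subtype.ext
    (map_smul f.hom.hom (algebraMap k (ActionAlgebra k H X) r) v.1)

variable (k H X)

/-- The bundle of the fibres of a module over the action algebra. -/
def toBundle [Finite X] :
    FGModuleCat.{u} (ActionAlgebra k H X) ⥤ EquivariantBundle k H X where
  obj V :=
    { obj := fun p => FGModuleCat.of k (fiber V p.back)
      map := fun {p q} f => FGModuleCat.ofHom (fiberMap V (label f) (label_smul f))
      map_id := fun p => by
        ext v
        exact mem_fiber.1 v.2
      map_comp := fun {p q r} f g => by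
        ext v
        exact (smul_single_smul _ _ _ _ (label_smul f) v.1).symm }
  map f := { app := fun p => FGModuleCat.ofHom (fiberHom f p.back)
             naturality := fun p q g => by
              ext v
              exact map_smul f.hom.hom _ v.1 }

variable {k H X}

/-- The space of sections of a bundle (for finite `X`, the direct sum of its fibres). -/
def Sections (B : EquivariantBundle k H X) : Type u := ∀ x : X, B.obj (pt H x)

instance instAddCommGroupSections (B : EquivariantBundle k H X) : AddCommGroup (Sections B) :=
  inferInstanceAs (AddCommGroup (∀ x : X, B.obj (pt H x)))

/-- The map `h : B x → B (h • x)` of a bundle. -/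
def bundleMap (B : EquivariantBundle k H X) (h : H) {x y : X} (hy : h • x = y) :
    B.obj (pt H x) →ₗ[k] B.obj (pt H y) :=
  (B.map (arrow h hy)).hom.hom

theorem bundleMap_one (B : EquivariantBundle k H X) {x : X} (hx : (1 : H) • x = x)
    (v : B.obj (pt H x)) : bundleMap B 1 hx v = v :=
  congrArg (fun f => f.hom.hom v) (B.map_id (pt H x))

theorem bundleMap_comp (B : EquivariantBundle k H X) {h h' : H} {x y z : X} (hy : h' • x = y)
    (hz : h • y = z) (hz' : (h * h') • x = z) (v : B.obj (pt H x)) :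
    bundleMap B h hz (bundleMap B h' hy v) = bundleMap B (h * h') hz' v :=
  (congrArg (fun f => f.hom.hom v) (B.map_comp (arrow h' hy) (arrow h hz))).symm

theorem bundleMap_congr (B : EquivariantBundle k H X) {h h' : H} {x x' y : X} (e : h = h')
    (hy : h • x = y) (hy' : h' • x' = y) (s : Sections B) :
    bundleMap B h hy (s x) = bundleMap B h' hy' (s x') := by
  subst e
  obtain rfl : x = x' := smul_left_cancel h (hy.trans hy'.symm)
  rfl

theorem bundleMap_hom {B B' : EquivariantBundle k H X} (f : B ⟶ B') {h : H} {x y : X}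
    (hy : h • x = y) (v : B.obj (pt H x)) :
    bundleMap B' h hy ((f.app (pt H x)).hom.hom v) =
      (f.app (pt H y)).hom.hom (bundleMap B h hy v) :=
  (congrArg (fun f => f.hom.hom v) (f.naturality (arrow h hy))).symm

/-- The action algebra acts on sections: `h ⊗ δ_x` sends `s` to the section supported at `h • x`
with value `h (s x)` there. -/
instance instSMulSections (B : EquivariantBundle k H X) : SMul (ActionAlgebra k H X) (Sections B) where
  smul a s := fun y => ∑ h : H, a h (h⁻¹ • y) • bundleMap B h (smul_inv_smul h y) (s (h⁻¹ • y))

theorem smul_section_apply (B : EquivariantBundle k H X) (a : ActionAlgebra k H X)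
    (s : Sections B) (y : X) :
    (a • s) y = ∑ h : H, a h (h⁻¹ • y) • bundleMap B h (smul_inv_smul h y) (s (h⁻¹ • y)) := rfl

theorem ofFun_smul_section (B : EquivariantBundle k H X) (f : X → k) (s : Sections B) (y : X) :
    ((ofFun f : ActionAlgebra k H X) • s) y = f y • s y := by
  classical
  rw [smul_section_apply, Finset.sum_eq_single 1]
  · rw [ofFun_apply, if_pos rfl, bundleMap_congr B rfl _ (one_smul H y) s, bundleMap_one, inv_one,
      one_smul]
  · intro h _ hh
    rw [ofFun_apply, if_neg hh, zero_smul]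
  · simp

theorem section_add_apply (B : EquivariantBundle k H X) (s t : Sections B) (y : X) :
    (s + t) y = s y + t y := rfl

instance instModuleSections (B : EquivariantBundle k H X) : Module (ActionAlgebra k H X) (Sections B) where
  one_smul s := funext fun y => by rw [one_def, ofFun_smul_section, one_smul]
  smul_zero a := funext fun y => by
    rw [smul_section_apply]
    exact Finset.sum_eq_zero fun h _ => (congrArg _ (map_zero _)).trans (smul_zero _)
  zero_smul s := funext fun y => by
    rw [smul_section_apply]
    exact Finset.sum_eq_zero fun h _ => zero_smul _ _
  smul_add a s t := funext fun y => by
    simp only [smul_section_apply, section_add_apply, map_add, smul_add, Finset.sum_add_distrib]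
  add_smul a b s := funext fun y => by
    simp only [smul_section_apply, section_add_apply, add_apply, add_smul,
      Finset.sum_add_distrib]
  mul_smul a b s := funext fun y => by
    simp only [smul_section_apply, mul_apply, Finset.sum_smul, map_sum, map_smul, Finset.smul_sum]
    rw [Finset.sum_comm' (t' := Finset.univ) (s' := fun _ => Finset.univ) (by simp)]
    conv_rhs => rw [Finset.sum_comm' (t' := Finset.univ) (s' := fun _ => Finset.univ) (by simp)]
    refine Finset.sum_congr rfl fun m _ => ?_
    conv_lhs => rw [← Equiv.sum_comp (Equiv.mulRight m)]
    refine Finset.sum_congr rfl fun l _ => ?_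
    have e : (l * m)⁻¹ • y = m⁻¹ • l⁻¹ • y := by rw [mul_inv_rev, mul_smul]
    have e' : (l * m) • m⁻¹ • l⁻¹ • y = y := by rw [mul_smul, smul_inv_smul, smul_inv_smul]
    have hs := bundleMap_congr B rfl (smul_inv_smul (l * m) y) e' s
    have hc : a (l * m * m⁻¹) (m • (l * m)⁻¹ • y) * b m ((l * m)⁻¹ • y) =
        a l (l⁻¹ • y) * b m (m⁻¹ • l⁻¹ • y) := by
      rw [e, smul_inv_smul, mul_inv_cancel_right]
    rw [bundleMap_comp B _ _ e']
    exact (congrArg₂ (fun (c : k) v => c • v) hc hs).trans (mul_smul _ _ _)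

theorem algebraMap_eq (r : k) :
    algebraMap k (ActionAlgebra k H X) r = ofFun fun _ => r := by
  ext g x
  rw [Algebra.algebraMap_eq_smul_one, one_def, smul_apply, ofFun_apply, ofFun_apply]
  split_ifs <;> simp

open Classical in
theorem single_eq_ofFun (x : X) :
    (single 1 x : ActionAlgebra k H X) = ofFun fun y => if y = x then 1 else 0 := by
  ext g y
  rw [single_apply, ofFun_apply]
  split_ifs <;> simp_all

theorem single_smul_section (B : EquivariantBundle k H X) (h : H) {x y : X} (hy : h • x = y)
    (s : Sections B) :
    ((single h x : ActionAlgebra k H X) • s) y = bundleMap B h hy (s x) := by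
  classical
  rw [smul_section_apply, Finset.sum_eq_single h]
  · rw [single_apply, if_pos ⟨rfl, by rw [← hy, inv_smul_smul]⟩, one_smul]
    exact bundleMap_congr B rfl _ _ s
  · intro l _ hl
    rw [single_apply, if_neg (fun hh => hl hh.1), zero_smul]
  · simp

theorem single_one_smul_section (B : EquivariantBundle k H X) (x : X) (s : Sections B) :
    ((single 1 x : ActionAlgebra k H X) • s) x = s x := by
  rw [single_eq_ofFun, ofFun_smul_section, if_pos rfl, one_smul]

theorem single_one_smul_section_ne (B : EquivariantBundle k H X) {x y : X} (hy : y ≠ x)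
    (s : Sections B) : ((single 1 x : ActionAlgebra k H X) • s) y = 0 := by
  rw [single_eq_ofFun, ofFun_smul_section, if_neg hy, zero_smul]

/-- Scalars act on sections pointwise. -/
theorem algebraMap_smul_section (B : EquivariantBundle k H X) (r : k) (s : Sections B) (y : X) :
    (algebraMap k (ActionAlgebra k H X) r • s) y = r • s y := by
  rw [algebraMap_eq, ofFun_smul_section]

instance instFiniteSections [Finite X] (B : EquivariantBundle k H X) :
    Module.Finite (ActionAlgebra k H X) (Sections B) := by
  let _ : Module k (Sections B) := Module.restrictScalars k (ActionAlgebra k H X) (Sections B)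
  have : IsScalarTower k (ActionAlgebra k H X) (Sections B) :=
    IsScalarTower.restrictScalars k (ActionAlgebra k H X) (Sections B)
  let e : Sections B ≃ₗ[k] (∀ x : X, B.obj (pt H x)) :=
    { toFun := fun s => s
      invFun := fun s => s
      map_add' := fun _ _ => rfl
      map_smul' := fun r s => funext fun y => algebraMap_smul_section B r s y
      left_inv := fun _ => rfl
      right_inv := fun _ => rfl }
  have : Module.Finite k (Sections B) := Module.Finite.equiv e.symm
  exact Module.Finite.of_restrictScalars_finite k (ActionAlgebra k H X) (Sections B)

variable (k H X)

/-- The module of sections of a bundle. -/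
def ofBundle [Finite X] : EquivariantBundle k H X ⥤ FGModuleCat.{u} (ActionAlgebra k H X) where
  obj B := FGModuleCat.of _ (Sections B)
  map {B B'} f := FGModuleCat.ofHom
    { toFun := fun s x => (f.app (pt H x)).hom.hom (s x)
      map_add' := fun s t => funext fun x => map_add _ (s x) (t x)
      map_smul' := fun a s => funext fun x => by
        refine (map_sum (f.app (pt H x)).hom.hom _ _).trans (Finset.sum_congr rfl fun h _ => ?_)
        exact (map_smul _ _ _).trans (congrArg _ (bundleMap_hom f _ _).symm) }

open Classical in
/-- The section supported at `x` with value `v` there. -/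
def singleSection (B : EquivariantBundle k H X) (x : X) (v : B.obj (pt H x)) : Sections B :=
  Pi.single (M := fun x => B.obj (pt H x)) x v

theorem singleSection_same (B : EquivariantBundle k H X) (x : X) (v : B.obj (pt H x)) :
    singleSection k H X B x v x = v := by
  classical exact Pi.single_eq_same (M := fun x => B.obj (pt H x)) x v

theorem singleSection_ne (B : EquivariantBundle k H X) {x y : X} (hy : y ≠ x)
    (v : B.obj (pt H x)) : singleSection k H X B x v y = 0 := by
  classical exact Pi.single_eq_of_ne (M := fun x => B.obj (pt H x)) hy v

theorem singleSection_mem [Finite X] (B : EquivariantBundle k H X) (x : X) (v : B.obj (pt H x)) :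
    (singleSection k H X B x v : (ofBundle k H X).obj B) ∈ fiber ((ofBundle k H X).obj B) x :=
  funext fun y => by
    by_cases hy : y = x
    · subst hy
      exact single_one_smul_section B y _
    · exact (single_one_smul_section_ne B hy _).trans (singleSection_ne k H X B hy v).symm

/-- The fibre of the module of sections over `x` is the fibre of the bundle over `x`. -/
def fiberSections [Finite X] (B : EquivariantBundle k H X) (x : X) :
    fiber ((ofBundle k H X).obj B) x ≃ₗ[k] B.obj (pt H x) where
  toFun s := (show Sections B from s.1) x
  map_add' _ _ := rfl
  map_smul' r s := algebraMap_smul_section B r s.1 x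
  invFun v := ⟨singleSection k H X B x v, singleSection_mem k H X B x v⟩
  left_inv s := by
    refine Subtype.ext (funext fun y => ?_)
    by_cases hy : y = x
    · subst hy
      exact singleSection_same k H X B y _
    · refine (singleSection_ne k H X B hy _).trans ?_
      have h := single_one_smul_section_ne B hy s.1
      exact h.symm.trans (congrFun (mem_fiber.1 s.2) y)
  right_inv v := singleSection_same k H X B x v

variable {H X} in
theorem single_one_mul (x : X) (a : ActionAlgebra k H X) :
    single 1 x * a = ∑ h, a h (h⁻¹ • x) • (single h (h⁻¹ • x) : ActionAlgebra k H X) := by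
  classical
  ext g y
  rw [single_eq_ofFun, ofFun_mul, sum_apply, Finset.sum_eq_single g]
  · rw [smul_apply, single_apply]
    by_cases e : g • y = x
    · subst e; simp
    · have : ¬ y = g⁻¹ • x := fun h => e (by rw [h, smul_inv_smul])
      simp [e, this]
  · intro h _ hh
    rw [smul_apply, single_apply, if_neg (fun e => hh e.1.symm), mul_zero]
  · simp

/-- A module is the space of sections of the bundle of its fibres. -/
def sectionsFiber [Fintype X] (V : FGModuleCat.{u} (ActionAlgebra k H X)) :
    V ≃ₗ[ActionAlgebra k H X] Sections ((toBundle k H X).obj V) where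
  toFun v := fun x => ⟨(single 1 x : ActionAlgebra k H X) • v,
    single_smul_mem V (one_smul H x) v⟩
  map_add' v w := funext fun x => Subtype.ext (smul_add _ v w)
  map_smul' a v := funext fun x => Subtype.ext <| by
    refine Eq.trans ?_ (Submodule.coe_sum (fiber V x) _ _).symm
    refine (smul_smul _ _ _).trans ?_
    rw [single_one_mul, Finset.sum_smul]
    refine Finset.sum_congr rfl fun h _ => ?_
    refine (smul_assoc _ _ _).trans (congrArg _ ?_)
    exact ((smul_single_smul _ _ _ _ (one_smul _ _) _).trans (by rw [mul_one]; rfl)).symm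
  invFun s := ∑ x, ((show fiber V x from s x) : V)
  left_inv v := (Finset.sum_smul).symm.trans (by rw [sum_single_one, one_smul])
  right_inv s := funext fun x => Subtype.ext <| by
    refine Finset.smul_sum.trans ((Finset.sum_eq_single x ?_ (by simp)).trans ?_)
    · intro y _ hy
      exact single_smul_of_mem (show fiber V y from s y).2 _ hy.symm
    · exact (show fiber V x from s x).2

/-- The fibres of the module of sections of a bundle form the given bundle. -/
def fiberSectionsIso [Finite X] : ofBundle k H X ⋙ toBundle k H X ≅ 𝟭 _ :=
  NatIso.ofComponents
    (fun B => NatIso.ofComponents (fun p => (fiberSections k H X B p.back).toFGModuleCatIso)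
      (fun {p q} f => by
        ext s
        exact single_smul_section B (label f) (label_smul f) s.1))
    (fun {B B'} f => by
      ext p s
      rfl)

/-- A module is the module of sections of the bundle of its fibres, naturally. -/
def sectionsFiberIso [Fintype X] : 𝟭 _ ≅ toBundle k H X ⋙ ofBundle k H X :=
  NatIso.ofComponents (fun V => (sectionsFiber k H X V).toFGModuleCatIso)
    (fun {V W} f => by
      ext v
      exact funext fun x => Subtype.ext (map_smul f.hom.hom _ v).symm)

/-- Equivariant bundles are the same as modules over the action algebra: a bundle corresponds to
the module of its sections, a module to the bundle of its fibres. -/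
def bundleEquivalence [Fintype X] :
    EquivariantBundle k H X ≌ FGModuleCat.{u} (ActionAlgebra k H X) where
  functor := ofBundle k H X
  inverse := toBundle k H X
  unitIso := (fiberSectionsIso k H X).symm
  counitIso := (sectionsFiberIso k H X).symm
  functor_unitIso_comp B := by
    refine (Iso.comp_inv_eq ((sectionsFiberIso k H X).app _)).2 ?_
    rw [Category.id_comp]
    ext s
    refine funext fun x => ?_
    refine (fiberSections k H X B x).injective ?_
    refine ((fiberSections k H X B x).apply_symm_apply _).trans ?_
    exact (single_one_smul_section B x s).symm

/-! ## The fibrewise tensor product -/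

/-- The fibrewise tensor product of finite-dimensional modules over the action algebra:
`(V ⊗ W)_x = V_x ⊗ W_x` with `H` acting diagonally (see `tensorObj_carrier`, `single_smul_tensor`),
with the usual associator and unitors of vector spaces in each fibre. -/
instance fiberwiseMonoidal [Fintype X] : MonoidalCategory (FGModuleCat.{u} (ActionAlgebra k H X)) :=
  Monoidal.transport (bundleEquivalence k H X)

variable {k H X}

theorem tensorObj_carrier [Fintype X] (V W : FGModuleCat.{u} (ActionAlgebra k H X)) :
    ((V ⊗ W : FGModuleCat.{u} (ActionAlgebra k H X)) : Type u) =
      ∀ x : X, TensorProduct k (fiber V x) (fiber W x) := rfl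

theorem tensorUnit_carrier [Fintype X] :
    ((𝟙_ (FGModuleCat.{u} (ActionAlgebra k H X)) : FGModuleCat.{u} (ActionAlgebra k H X)) : Type u)
      = (X → k) := rfl

theorem single_smul_unit [Fintype X] (h : H) {x y : X} (hy : h • x = y)
    (s : (𝟙_ (FGModuleCat.{u} (ActionAlgebra k H X)) : FGModuleCat.{u} (ActionAlgebra k H X))) :
    (show X → k from (single h x : ActionAlgebra k H X) • s) y = (show X → k from s) x :=
  single_smul_section _ h hy s

open TensorProduct in
theorem single_smul_tensor [Fintype X] (V W : FGModuleCat.{u} (ActionAlgebra k H X)) (h : H)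
    {x y : X} (hy : h • x = y) (s : (V ⊗ W : FGModuleCat.{u} (ActionAlgebra k H X)))
    (v : fiber V x) (w : fiber W x)
    (hs : (show ∀ x : X, TensorProduct k (fiber V x) (fiber W x) from s) x = v ⊗ₜ[k] w) :
    (show ∀ x : X, TensorProduct k (fiber V x) (fiber W x) from
      (single h x : ActionAlgebra k H X) • s) y = fiberMap V h hy v ⊗ₜ[k] fiberMap W h hy w := by
  refine (single_smul_section _ h hy s).trans ?_
  refine (congrArg _ hs).trans ?_
  rfl

instance instMonoidalPreadditiveBundle : MonoidalPreadditive (EquivariantBundle k H X) where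
  whiskerLeft_zero := by intros; ext : 2; simp; rfl
  zero_whiskerRight := by intros; ext : 2; simp; rfl
  whiskerLeft_add := by intros; ext : 2; simp; rfl
  add_whiskerRight := by intros; ext : 2; simp; rfl

instance instMonoidalLinearBundle : MonoidalLinear k (EquivariantBundle k H X) where
  whiskerLeft_smul := by intros; ext : 2; simp; rfl
  smul_whiskerRight := by intros; ext : 2; simp; rfl

instance instAdditiveToBundle [Finite X] : (toBundle k H X).Additive where
  map_add := by intros; rfl

instance instLinearToBundle [Finite X] : (toBundle k H X).Linear k where
  map_smul := by intros; rfl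

instance instMonoidalToBundle [Fintype X] : (toBundle k H X).Monoidal :=
  inferInstanceAs (Monoidal.equivalenceTransported (bundleEquivalence k H X)).inverse.Monoidal

instance instIsEquivalenceToBundle [Fintype X] : (toBundle k H X).IsEquivalence :=
  inferInstanceAs (bundleEquivalence k H X).inverse.IsEquivalence

instance instMonoidalPreadditive [Fintype X] : MonoidalPreadditive (FGModuleCat.{u} (ActionAlgebra k H X)) :=
  monoidalPreadditive_of_faithful (toBundle k H X)

instance instMonoidalLinear [Fintype X] : MonoidalLinear k (FGModuleCat.{u} (ActionAlgebra k H X)) :=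
  MonoidalLinear.ofFaithful k (toBundle k H X)

end ActionAlgebra

/-! ## The Drinfeld double and the algebra of the torus -/

section Double

variable (k G : Type u) [Field k] [Group G] [Fintype G]

/-- The action of `G` on itself by conjugation. -/
instance conjAction : MulAction (ConjAct G) G := MulDistribMulAction.toMulAction

/-- The action of `G` on pairs by simultaneous conjugation. -/
instance conjActionPairs : MulAction (ConjAct G) (G × G) := Prod.mulAction

theorem conjAction_def (g h : G) : ConjAct.toConjAct g • h = g * h * g⁻¹ := rfl

theorem conjActionPairs_def (g : G) (p : G × G) :
    ConjAct.toConjAct g • p = (g * p.1 * g⁻¹, g * p.2 * g⁻¹) := rfl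

/-- The Drinfeld double `D(G) = k[G] ⊗ F(G)`, the action algebra of `G` acting on itself by
conjugation; its modules are the `G`-equivariant bundles over `G`. -/
abbrev DrinfeldDouble := ActionAlgebra k (ConjAct G) G

/-- The elliptic double `k[G] ⊗ F(G) ⊗ F(G)`, the action algebra of `G` acting on `G × G` by
simultaneous conjugation. -/
abbrev EllipticDouble := ActionAlgebra k (ConjAct G) (G × G)

/-- The conjugation-invariant set `Ω` of commuting pairs in `G × G`. -/
def CommutingPairs (G : Type u) [Group G] : SubMulAction (ConjAct G) (G × G) where
  carrier := {p | p.1 * p.2 = p.2 * p.1}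
  smul_mem' g p hp :=
    (smul_mul' g p.1 p.2).symm.trans ((congrArg (g • ·) hp).trans (smul_mul' g p.2 p.1))

/-- The action of `G` on commuting pairs by simultaneous conjugation. -/
instance conjActionCommutingPairs : MulAction (ConjAct G) (CommutingPairs G) :=
  SubMulAction.mulAction (CommutingPairs G)

theorem conjActionCommutingPairs_def (g : ConjAct G) (p : CommutingPairs G) :
    ((g • p : CommutingPairs G) : G × G) = g • (p : G × G) := rfl

variable {G} in
theorem smul_mem_commutingPairs (g : ConjAct G) (p : G × G) :
    g • p ∈ CommutingPairs G ↔ p ∈ CommutingPairs G :=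
  ⟨fun h => inv_smul_smul g p ▸ (CommutingPairs G).smul_mem g⁻¹ h,
    (CommutingPairs G).smul_mem g⟩

open Classical in
/-- The idempotent `δ_Ω = ∑_{(h, h') ∈ Ω} δ_{(h, h')}` of the elliptic double. -/
def deltaOmega : EllipticDouble k G :=
  ∑ p : CommutingPairs G, ActionAlgebra.single 1 (p : G × G)

open Classical in
theorem deltaOmega_eq :
    deltaOmega k G = ActionAlgebra.ofFun fun p => if p ∈ CommutingPairs G then 1 else 0 := by
  ext g p
  rw [deltaOmega, ActionAlgebra.sum_apply, ActionAlgebra.ofFun_apply]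
  by_cases hp : p ∈ CommutingPairs G
  · rw [Finset.sum_eq_single ⟨p, hp⟩]
    · simp [ActionAlgebra.single_apply, hp]
    · intro q _ hq
      rw [ActionAlgebra.single_apply, if_neg]
      exact fun h => hq (Subtype.ext h.2.symm)
    · simp
  · rw [Finset.sum_eq_zero]
    · simp [hp]
    · intro q _
      rw [ActionAlgebra.single_apply, if_neg]
      exact fun h => hp (h.2 ▸ q.2)

theorem deltaOmega_comm (a : EllipticDouble k G) : deltaOmega k G * a = a * deltaOmega k G := by
  classical
  ext g p
  rw [deltaOmega_eq, ActionAlgebra.ofFun_mul, ActionAlgebra.mul_ofFun, mul_comm]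
  exact congrArg (a g p * ·) (if_congr (smul_mem_commutingPairs g p) rfl rfl)

theorem deltaOmega_mul_self : deltaOmega k G * deltaOmega k G = deltaOmega k G := by
  classical
  ext g p
  conv_lhs => rw [deltaOmega_eq, ActionAlgebra.mul_ofFun]
  rw [deltaOmega_eq, ActionAlgebra.ofFun_apply]
  split_ifs <;> simp

/-- The algebra `D_{T²}(G) = D^el(G) · δ_Ω`, as a subspace of the elliptic double that is closed
under multiplication; it is spanned by the `g ⊗ δ_{(h, h')}` with `(h, h')` in `Ω`, and its unit
is `δ_Ω`. -/
def torusSubalgebra : NonUnitalSubalgebra k (EllipticDouble k G) where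
  carrier := {b | ∃ a, b = a * deltaOmega k G}
  zero_mem' := ⟨0, (zero_mul _).symm⟩
  add_mem' := by
    rintro _ _ ⟨a, rfl⟩ ⟨b, rfl⟩
    exact ⟨a + b, (add_mul _ _ _).symm⟩
  mul_mem' := by
    rintro _ _ ⟨a, rfl⟩ ⟨b, rfl⟩
    exact ⟨a * deltaOmega k G * b, (mul_assoc _ _ _).symm⟩
  smul_mem' := by
    rintro r _ ⟨a, rfl⟩
    exact ⟨r • a, (smul_mul_assoc r a _).symm⟩

/-- The algebra `D_{T²}(G)`. -/
abbrev TorusDouble := torusSubalgebra k G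

theorem mul_deltaOmega_of_mem {b : EllipticDouble k G} (hb : b ∈ torusSubalgebra k G) :
    b * deltaOmega k G = b := by
  obtain ⟨a, rfl⟩ := hb
  rw [mul_assoc, deltaOmega_mul_self]

instance instOneTorusDouble : One (TorusDouble k G) := ⟨⟨deltaOmega k G, 1, (one_mul _).symm⟩⟩

instance instRingTorusDouble : Ring (TorusDouble k G) where
  __ := (inferInstance : NonUnitalRing (TorusDouble k G))
  one := 1
  one_mul b := Subtype.ext <|
    (deltaOmega_comm k G b.1).trans (mul_deltaOmega_of_mem k G b.2)
  mul_one b := Subtype.ext (mul_deltaOmega_of_mem k G b.2)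

instance instAlgebraTorusDouble : Algebra k (TorusDouble k G) :=
  Algebra.ofModule (fun r a b => smul_mul_assoc r a b) (fun r a b => mul_smul_comm r a b)

end Double

end

/-! Everything is proved for a finite group `H` acting on a finite set `X`; the theorem is the case
of conjugation. Modules over the action algebra are equivariant bundles over `X` with the fibrewise
tensor product, and half-braidings on `V` amount to gradings of each fibre `V_x` by the stabilizer
of `x`, compatible with the action of `H`. A bundle with such a grading is a bundle over the inertia
set of pairs `(x, h)` with `h x = x`. For conjugation these are the commuting pairs, and `D_{T²}(G)`
is the action algebra of that set.

The grading is extracted with the regular module. A vector `u` in `U_x` is the image of `δ_x` under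
a morphism from the regular module, so by naturality the half-braiding over `x` is determined by its
values on `v ⊗ δ_x`. Expanding these in the coefficients of the regular module gives the formula `v
⊗ u ↦ ∑ h u ⊗ p_h v` over the stabilizer of `x` (`braid_tmul`). Coefficients are then compared in
each axiom. Equivariance of the half-braiding gives `p_{g h g⁻¹} g = g p_h` (`proj_fiberMap`), the
hexagon gives `p_g p_h = 0` for `g ≠ h` and `p_h p_h = p_h` (`proj_proj`), and injectivity then
forces `∑ p_h = 1` (`sum_proj`). Conversely, the same formula turns any such family of projections
into a half-braiding (`StabilizerGrading.halfBraiding`).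

The projections `p_h` on `V_x` and the action of `H` assemble into an action of the action algebra
of the inertia set (`StabilizerGrading.action`), with `δ_{(x, h)}` acting as `p_h δ_x`. Morphisms of
the center are the module maps that commute with all `p_h` (`center_comm_iff_proj`), so the
resulting functor `centerToInertia` is a linear equivalence. The abelian structure on the center is
transported along it. -/

noncomputable section

/-! ### Abelian structures and half-braidings carried along functors -/

namespace CategoryTheory

/-- A category that is additively equivalent to an abelian category is abelian. -/
theorem IsAbelianCategory.of_isEquivalence {C D : Type*} [Category* C] [Category* D]
    [Preadditive C] [Abelian D] (F : C ⥤ D) [F.IsEquivalence] : IsAbelianCategory C := by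
  have : Limits.HasFiniteProducts C :=
    ⟨fun _ => Adjunction.hasLimitsOfShape_of_equivalence F⟩
  -- The transported structure is built on the given addition of morphisms, hence `rfl`.
  exact ⟨abelianOfEquivalence F, rfl⟩

namespace HalfBraiding

open Functor.LaxMonoidal Functor.OplaxMonoidal

variable {C D : Type*} [Category* C] [Category* D] [MonoidalCategory C] [MonoidalCategory D]
  (F : C ⥤ D) [F.Monoidal]

/-- The image of a half-braiding under a monoidal functor `F`. -/
def image {V : C} (b : HalfBraiding V) (U : C) : F.obj V ⊗ F.obj U ⟶ F.obj U ⊗ F.obj V :=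
  μ F V U ≫ F.map (b.β U).hom ≫ δ F U V

variable {F}

instance {V : C} (b : HalfBraiding V) (U : C) : IsIso (b.image F U) := by
  unfold image; infer_instance

theorem image_naturality {V : C} (b : HalfBraiding V) {U U' : C} (f : U ⟶ U') :
    F.obj V ◁ F.map f ≫ b.image F U' = b.image F U ≫ F.map f ▷ F.obj V := by
  simp only [image, Category.assoc]
  rw [δ_natural_left, ← F.map_comp_assoc (b.β U).hom, ← b.naturality, F.map_comp_assoc,
    μ_natural_right_assoc]

/-- The image under `F` of the hexagon axiom. In the application `F` takes values in bundles, where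
tensor products are computed fibre by fibre. -/
theorem image_tensor {V : C} (b : HalfBraiding V) (U U' : C) :
    F.obj V ◁ μ F U U' ≫ b.image F (U ⊗ U') ≫ δ F U U' ▷ F.obj V =
      (α_ _ _ _).inv ≫ b.image F U ▷ F.obj U' ≫ (α_ _ _ _).hom ≫ F.obj U ◁ b.image F U' ≫
        (α_ _ _ _).inv := by
  simp only [image, b.monoidal, F.map_comp, Functor.Monoidal.map_whiskerLeft,
    Functor.Monoidal.map_whiskerRight, Functor.Monoidal.map_associator,
    Functor.Monoidal.map_associator_inv, Category.assoc, comp_whiskerRight,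
    MonoidalCategory.whiskerLeft_comp, Functor.Monoidal.μ_δ_assoc,
    Functor.Monoidal.whiskerLeft_μ_δ_assoc, Functor.Monoidal.whiskerRight_μ_δ, Category.comp_id]

theorem image_comm_iff [F.Faithful] {A B : Center C} (f : A.1 ⟶ B.1) (U : C) :
    F.map f ▷ F.obj U ≫ B.2.image F U = A.2.image F U ≫ F.obj U ◁ F.map f ↔
      f ▷ U ≫ (B.2.β U).hom = (A.2.β U).hom ≫ U ◁ f := by
  rw [← F.map_injective.eq_iff]
  simp only [image, F.map_comp, Functor.Monoidal.map_whiskerLeft,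
    Functor.Monoidal.map_whiskerRight, Category.assoc]
  rw [← cancel_epi (δ F A.1 U), ← cancel_mono (μ F U B.1)]
  simp

variable (F) in
/-- A half-braiding can be given through a fully faithful monoidal functor. -/
def ofImage [F.Full] [F.Faithful] {V : C} (c : ∀ U, F.obj V ⊗ F.obj U ≅ F.obj U ⊗ F.obj V)
    (hn : ∀ {U U' : C} (f : U ⟶ U'),
      F.obj V ◁ F.map f ≫ (c U').hom = (c U).hom ≫ F.map f ▷ F.obj V)
    (hm : ∀ U U' : C, F.obj V ◁ μ F U U' ≫ (c (U ⊗ U')).hom ≫ δ F U U' ▷ F.obj V =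
      (α_ _ _ _).inv ≫ (c U).hom ▷ F.obj U' ≫ (α_ _ _ _).hom ≫ F.obj U ◁ (c U').hom ≫
        (α_ _ _ _).inv) : HalfBraiding V where
  β U := F.preimageIso ((Functor.Monoidal.μIso F V U).symm ≪≫ c U ≪≫ Functor.Monoidal.μIso F U V)
  monoidal U U' := F.map_injective <| by
    have h := hm U U'
    -- This isolates `c (U ⊗ U')`, so that `h` expresses it through `c U` and `c U'`.
    rw [← cancel_mono (μ F U U' ▷ F.obj V), ← cancel_epi (F.obj V ◁ δ F U U')] at h
    simp only [Category.assoc, Functor.Monoidal.whiskerRight_δ_μ, Category.comp_id,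
      Functor.Monoidal.whiskerLeft_δ_μ_assoc] at h
    simp only [Functor.preimageIso_hom, Functor.map_preimage, Iso.trans_hom, Iso.symm_hom,
      Functor.Monoidal.μIso_hom, Functor.Monoidal.μIso_inv, F.map_comp,
      Functor.Monoidal.map_whiskerLeft, Functor.Monoidal.map_whiskerRight,
      Functor.Monoidal.map_associator, Functor.Monoidal.map_associator_inv, Category.assoc,
      comp_whiskerRight, MonoidalCategory.whiskerLeft_comp, Functor.Monoidal.μ_δ_assoc,
      Functor.Monoidal.whiskerRight_μ_δ_assoc, Functor.Monoidal.whiskerLeft_μ_δ_assoc]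
    rw [reassoc_of% h]
  naturality {U U'} f := F.map_injective <| by
    simp only [Functor.preimageIso_hom, Functor.map_preimage, Iso.trans_hom, Iso.symm_hom,
      Functor.Monoidal.μIso_hom, Functor.Monoidal.μIso_inv, F.map_comp, Category.assoc,
      Functor.Monoidal.map_whiskerLeft, Functor.Monoidal.map_whiskerRight,
      Functor.Monoidal.μ_δ_assoc, reassoc_of% (hn f)]

theorem image_ofImage [F.Full] [F.Faithful] {V : C}
    (c : ∀ U, F.obj V ⊗ F.obj U ≅ F.obj U ⊗ F.obj V) (hn) (hm) (U : C) :
    (ofImage F c hn hm).image F U = (c U).hom := by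
  simp [image, ofImage]

end HalfBraiding

end CategoryTheory

/-! ### Restriction of scalars along ring isomorphisms -/

namespace FGModuleCat

variable {R S : Type u} [Ring R] [Ring S]

/-- Restriction of scalars along an isomorphism of rings. -/
def restrictScalarsEquiv (e : R ≃+* S) : FGModuleCat.{u} S ⥤ FGModuleCat.{u} R :=
  (ModuleCat.isFG R).lift ((ModuleCat.isFG S).ι ⋙ ModuleCat.restrictScalars e.toRingHom)
    fun M => by
      have : Module.Finite S M := M.2
      let _ : Module R M := Module.compHom M e.toRingHom
      -- The identity map is semilinear over the inverse isomorphism, so finite generation passes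
      -- across it.
      exact Module.Finite.of_surjective (σ := (e.symm : S →+* R))
        ({ AddMonoidHom.id M with
          map_smul' := fun s m => by
            change s • m = e (e.symm s) • m
            rw [e.apply_symm_apply] } : M →ₛₗ[(e.symm : S →+* R)] M) Function.surjective_id

instance (e : R ≃+* S) : (restrictScalarsEquiv e).IsEquivalence where
  faithful := ⟨fun {M N f g} h => by
    ext x
    exact congrArg (fun f => f.hom.hom x) h⟩
  full := ⟨fun {M N} f => by
    refine ⟨ofHom (V := M) (W := N) { f.hom.hom.toAddMonoidHom with
      map_smul' := fun s x => ?_ }, rfl⟩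
    obtain ⟨r, rfl⟩ := e.surjective s
    exact f.hom.hom.map_smul r x⟩
  essSurj := ⟨fun M => by
    let _ : Module S M := Module.compHom M e.symm.toRingHom
    have : Module.Finite S M := Module.Finite.of_surjective (σ := (e : R →+* S))
        ({ AddMonoidHom.id M with
          map_smul' := fun r m => by
            change r • m = e.symm (e r) • m
            rw [e.symm_apply_apply] } : M →ₛₗ[(e : R →+* S)] M) Function.surjective_id
    let e' : (ModuleCat.restrictScalars e.toRingHom).obj (ModuleCat.of S M) ≃ₗ[R] M.obj :=
      { AddEquiv.refl M with
        map_smul' := fun r m => by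
          change e.symm (e r) • (show M from m) = r • (show M from m)
          rw [e.symm_apply_apply] }
    exact ⟨FGModuleCat.of S M, ⟨(ModuleCat.isFG R).isoMk e'.toModuleIso⟩⟩⟩

instance (e : R ≃+* S) : (restrictScalarsEquiv e).Additive where
  map_add := rfl

open scoped ModuleCat in
instance {k : Type*} [Field k] [Algebra k R] [Algebra k S] (e : R ≃ₐ[k] S) :
    (restrictScalarsEquiv e.toRingEquiv).Linear k where
  map_smul {M N} f r := by
    ext x
    change (algebraMap k S r) • f.hom.hom x = e (algebraMap k R r) • f.hom.hom x
    rw [e.commutes]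

end FGModuleCat

/-! ### The torus algebra as the action algebra of the commuting pairs -/

section TorusDouble

variable (k G : Type u) [Field k] [Group G] [Fintype G]

instance instFiniteTorusDouble : Module.Finite k (TorusDouble k G) :=
  inferInstanceAs (Module.Finite k (torusSubalgebra k G).toSubmodule)

/-- Over a Noetherian ring the finitely generated modules form an abelian category. -/
instance instIsNoetherianRingTorusDouble : IsNoetherianRing (TorusDouble k G) :=
  IsNoetherianRing.of_finite k _

variable {k G} in
theorem torusDouble_apply_eq_zero (b : TorusDouble k G) (g : ConjAct G) {p : G × G}
    (hp : p ∉ CommutingPairs G) : b.1 g p = 0 := by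
  classical
  rw [← mul_deltaOmega_of_mem k G b.2, deltaOmega_eq, ActionAlgebra.mul_ofFun, if_neg hp, mul_zero]

theorem torusDouble_one_apply (g : ConjAct G) (p : CommutingPairs G) :
    (1 : TorusDouble k G).1 g p.1 = (1 : ActionAlgebra k (ConjAct G) (CommutingPairs G)) g p := by
  classical
  change deltaOmega k G g p.1 = _
  rw [deltaOmega_eq, ActionAlgebra.one_def, ActionAlgebra.ofFun_apply, ActionAlgebra.ofFun_apply,
    if_pos p.2]

open Classical in
/-- The algebra `D_{T²}(G)` is the action algebra of `G` acting on the commuting pairs. -/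
def torusDoubleEquiv : TorusDouble k G ≃ₐ[k] ActionAlgebra k (ConjAct G) (CommutingPairs G) where
  toFun b := .mk fun g p => b.1 g p.1
  invFun a :=
    ⟨.mk fun g p => if hp : p ∈ CommutingPairs G then a g ⟨p, hp⟩ else 0, by
      refine ⟨.mk fun g p => if hp : p ∈ CommutingPairs G then a g ⟨p, hp⟩ else 0, ?_⟩
      ext g p
      rw [deltaOmega_eq, ActionAlgebra.mul_ofFun]
      change dite _ _ _ = (dite _ _ _) * _
      split_ifs <;> simp⟩
  left_inv b := Subtype.ext <| ActionAlgebra.ext fun g p => by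
    change dite _ _ _ = _
    split_ifs with hp
    · rfl
    · exact (torusDouble_apply_eq_zero b g hp).symm
  right_inv a := ActionAlgebra.ext fun g p => dif_pos p.2
  -- The product at `(g, p)` only involves coefficients at `p` and its conjugates, so restriction to
  -- the stable set `Ω` is multiplicative by definition.
  map_mul' _ _ := rfl
  map_add' _ _ := rfl
  commutes' r := ActionAlgebra.ext fun g p => by
    rw [Algebra.algebraMap_eq_smul_one, Algebra.algebraMap_eq_smul_one, ActionAlgebra.smul_apply,
      ← torusDouble_one_apply]
    rfl

end TorusDouble

/-! ### Functoriality of action algebras, and the inertia set -/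

namespace ActionAlgebra

/-- A map of `H`-sets induces a homomorphism of action algebras, by pulling back functions. -/
def comap (k : Type u) {H X Y : Type u} [Field k] [Group H] [Fintype H] [MulAction H X]
    [MulAction H Y] (f : Y → X) (hf : ∀ (h : H) y, f (h • y) = h • f y) :
    ActionAlgebra k H X →ₐ[k] ActionAlgebra k H Y where
  toFun a := .mk fun h y => a h (f y)
  map_one' := rfl
  map_zero' := rfl
  map_mul' a b := ext fun g y => by
    change ∑ h, a (g * h⁻¹) (h • f y) * b h (f y) = ∑ h, a (g * h⁻¹) (f (h • y)) * b h (f y)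
    simp only [hf]
  map_add' _ _ := rfl
  commutes' r := by
    rw [algebraMap_eq, algebraMap_eq]
    rfl

/-- An isomorphism of `H`-sets induces an isomorphism of action algebras. -/
def congr (k : Type u) {H X Y : Type u} [Field k] [Group H] [Fintype H] [MulAction H X]
    [MulAction H Y] (e : X ≃ Y) (he : ∀ (h : H) x, e (h • x) = h • e x) :
    ActionAlgebra k H Y ≃ₐ[k] ActionAlgebra k H X :=
  AlgEquiv.ofAlgHom (comap k e he)
    (comap k e.symm fun h y => e.injective (by rw [he, e.apply_symm_apply, e.apply_symm_apply]))
    (AlgHom.ext fun a => ext fun h x => congrArg (a h) (e.symm_apply_apply x))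
    (AlgHom.ext fun a => ext fun h y => congrArg (a h) (e.apply_symm_apply y))

end ActionAlgebra

/-- The inertia set of an `H`-set `X`: the pairs of a point and an element of its stabilizer. -/
def Inertia (H X : Type*) [Group H] [MulAction H X] := {p : X × H // p.2 • p.1 = p.1}

namespace Inertia

variable {H X : Type*} [Group H] [MulAction H X]

/-- The point of `X` underlying an element of the inertia set. -/
def base (ω : Inertia H X) : X := ω.1.1

/-- The element of the stabilizer of the base point. -/
def loop (ω : Inertia H X) : H := ω.1.2

/-- The element of the inertia set with a given point and loop. -/
def of (x : X) (h : H) (hx : h • x = x) : Inertia H X := ⟨(x, h), hx⟩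

theorem loop_smul (ω : Inertia H X) : ω.loop • ω.base = ω.base := ω.2

@[ext] theorem ext {ω ω' : Inertia H X} (h₁ : ω.base = ω'.base) (h₂ : ω.loop = ω'.loop) :
    ω = ω' := Subtype.ext (Prod.ext h₁ h₂)

/-- The group acts on the inertia set by its action on points and by conjugation. -/
instance : MulAction H (Inertia H X) where
  smul h ω := ⟨(h • ω.base, h * ω.loop * h⁻¹), by simp [mul_smul, loop_smul]⟩
  one_smul ω := ext (one_smul _ _) (by change 1 * _ * 1⁻¹ = _; simp)
  mul_smul g h ω := ext (mul_smul g h ω.base) (by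
    change g * h * _ * (g * h)⁻¹ = g * (h * _ * h⁻¹) * g⁻¹
    simp [mul_assoc])

@[simp] theorem base_smul (h : H) (ω : Inertia H X) : (h • ω).base = h • ω.base := rfl

@[simp] theorem loop_smul_eq (h : H) (ω : Inertia H X) : (h • ω).loop = h * ω.loop * h⁻¹ := rfl

instance [Finite H] [Finite X] : Finite (Inertia H X) :=
  inferInstanceAs (Finite {p : X × H // p.2 • p.1 = p.1})

instance [Finite H] [Finite X] : Fintype (Inertia H X) := Fintype.ofFinite _

end Inertia

/-- For the conjugation action of `G` on itself, the inertia set is the set of commuting pairs. -/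
def inertiaEquivCommutingPairs (G : Type u) [Group G] :
    Inertia (ConjAct G) G ≃ CommutingPairs G where
  toFun ω := ⟨(ω.base, ConjAct.ofConjAct ω.loop), by
    have h := ω.loop_smul
    rw [ConjAct.smul_def, mul_inv_eq_iff_eq_mul] at h
    exact h.symm⟩
  invFun p := ⟨(p.1.1, ConjAct.toConjAct p.1.2), by
    have h : p.1.1 * p.1.2 = p.1.2 * p.1.1 := p.2
    rw [ConjAct.smul_def, ConjAct.ofConjAct_toConjAct, mul_inv_eq_iff_eq_mul, h]⟩
  left_inv _ := rfl
  right_inv _ := rfl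

theorem inertiaEquivCommutingPairs_smul {G : Type u} [Group G] (g : ConjAct G)
    (ω : Inertia (ConjAct G) G) :
    inertiaEquivCommutingPairs G (g • ω) = g • inertiaEquivCommutingPairs G ω :=
  rfl

/-! ### Half-braidings in the fibres -/

namespace ActionAlgebra

open scoped ModuleCat TensorProduct
open Functor.LaxMonoidal Functor.OplaxMonoidal

variable {k H X : Type u} [Field k] [Group H] [Fintype H] [MulAction H X] [Fintype X]

section Braid

variable {V : FGModuleCat.{u} (ActionAlgebra k H X)} (b : HalfBraiding V)

/-- A half-braiding in the fibre over `x`. -/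
def braid (U : FGModuleCat.{u} (ActionAlgebra k H X)) (x : X) :
    fiber V x ⊗[k] fiber U x →ₗ[k] fiber U x ⊗[k] fiber V x :=
  ((b.image (toBundle k H X) U).app (pt H x)).hom.hom

theorem braid_injective (U : FGModuleCat.{u} (ActionAlgebra k H X)) (x : X) :
    Function.Injective (braid b U x) :=
  (FGModuleCat.isoToLinearEquiv (asIso ((b.image (toBundle k H X) U).app (pt H x)))).injective

/-- Naturality of the half-braiding in its argument, read in one fibre. -/
theorem braid_fiberHom {U U' : FGModuleCat.{u} (ActionAlgebra k H X)} (f : U ⟶ U') (x : X)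
    (v : fiber V x) (u : fiber U x) :
    braid b U' x (v ⊗ₜ fiberHom f x u) = (fiberHom f x).rTensor _ (braid b U x (v ⊗ₜ u)) :=
  congrArg (fun g => (g.app (pt H x)).hom.hom (v ⊗ₜ[k] u))
    (b.image_naturality (F := toBundle k H X) f)

/-- Each half-braiding is a morphism of bundles, hence equivariant. -/
theorem braid_fiberMap (U : FGModuleCat.{u} (ActionAlgebra k H X)) {h : H} {x y : X}
    (hy : h • x = y) (v : fiber V x) (u : fiber U x) :
    braid b U y (fiberMap V h hy v ⊗ₜ fiberMap U h hy u) =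
      TensorProduct.map (fiberMap U h hy) (fiberMap V h hy) (braid b U x (v ⊗ₜ u)) :=
  congrArg (fun g => g.hom.hom (v ⊗ₜ[k] u)) ((b.image (toBundle k H X) U).naturality (arrow h hy))

/-- The fibre of a tensor product is the tensor product of the fibres. -/
def fiberTensor (U U' : FGModuleCat.{u} (ActionAlgebra k H X)) (x : X) :
    fiber U x ⊗[k] fiber U' x ≃ₗ[k] fiber (U ⊗ U') x :=
  FGModuleCat.isoToLinearEquiv ((Functor.Monoidal.μIso (toBundle k H X) U U').app (pt H x))

theorem fiberTensor_fiberMap (U U' : FGModuleCat.{u} (ActionAlgebra k H X)) {h : H} {x y : X}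
    (hy : h • x = y) (u : fiber U x) (u' : fiber U' x) :
    fiberTensor U U' y (fiberMap U h hy u ⊗ₜ fiberMap U' h hy u') =
      fiberMap (U ⊗ U') h hy (fiberTensor U U' x (u ⊗ₜ u')) :=
  congrArg (fun g => g.hom.hom (u ⊗ₜ[k] u')) ((μ (toBundle k H X) U U').naturality (arrow h hy))

/-- The hexagon axiom in one fibre. -/
theorem braid_tensor (U U' : FGModuleCat.{u} (ActionAlgebra k H X)) (x : X) (v : fiber V x)
    (u : fiber U x) (u' : fiber U' x) :
    (fiberTensor U U' x).symm.toLinearMap.rTensor _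
        (braid b (U ⊗ U') x (v ⊗ₜ fiberTensor U U' x (u ⊗ₜ u'))) =
      (TensorProduct.assoc k _ _ _).symm ((braid b U' x).lTensor _
        (TensorProduct.assoc k _ _ _ (braid b U x (v ⊗ₜ u) ⊗ₜ u'))) :=
  congrArg (fun g => (g.app (pt H x)).hom.hom (v ⊗ₜ[k] (u ⊗ₜ[k] u')))
    (b.image_tensor (F := toBundle k H X) U U')

theorem center_comm_iff {A B : Center (FGModuleCat.{u} (ActionAlgebra k H X))} (f : A.1 ⟶ B.1) :
    (∀ U, f ▷ U ≫ (B.2.β U).hom = (A.2.β U).hom ≫ U ◁ f) ↔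
      ∀ U x (v : fiber A.1 x) (u : fiber U x), braid B.2 U x (fiberHom f x v ⊗ₜ u) =
        (fiberHom f x).lTensor _ (braid A.2 U x (v ⊗ₜ u)) := by
  refine forall_congr' fun U => ?_
  rw [← HalfBraiding.image_comm_iff (F := toBundle k H X)]
  constructor
  · intro h x v u
    exact congrArg (fun g => (g.app (pt H x)).hom.hom (v ⊗ₜ[k] u)) h
  · intro h
    refine NatTrans.ext (funext fun p => FGModuleCat.hom_ext ?_)
    exact TensorProduct.ext' (M := fiber A.1 p.back) (N := fiber U p.back) fun v u =>
      h p.back v u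

end Braid

/-- The action of `h` on the fibre over `x`, if `h` fixes `x`, and zero otherwise. -/
def fiberLoop (V : FGModuleCat.{u} (ActionAlgebra k H X)) (x : X) (h : H) :
    fiber V x →ₗ[k] fiber V x where
  -- The vector `h v` lies over `h • x`, so `δ_x` kills it unless `h` fixes `x`. With this default
  -- value sums can run over all of `H` instead of a stabilizer depending on `x`.
  toFun v := ⟨(single 1 x : ActionAlgebra k H X) • (single h x : ActionAlgebra k H X) • v.1,
    single_smul_mem V (one_smul H x) _⟩
  map_add' v w := Subtype.ext <| by simp only [Submodule.coe_add, smul_add]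
  map_smul' r v := Subtype.ext <| by
    simp only [Submodule.coe_smul, smul_comm_scalar, RingHom.id_apply]

theorem fiberLoop_of_smul_eq (V : FGModuleCat.{u} (ActionAlgebra k H X)) {x : X} {h : H}
    (hx : h • x = x) : fiberLoop V x h = fiberMap V h hx :=
  LinearMap.ext fun v => Subtype.ext <| by
    change (single 1 x : ActionAlgebra k H X) • (single h x : ActionAlgebra k H X) • v.1 = _
    rw [smul_single_smul _ _ _ _ hx, one_mul]
    rfl

theorem fiberLoop_of_smul_ne (V : FGModuleCat.{u} (ActionAlgebra k H X)) {x : X} {h : H}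
    (hx : h • x ≠ x) : fiberLoop V x h = 0 :=
  LinearMap.ext fun v => Subtype.ext <| by
    change (single 1 x : ActionAlgebra k H X) • (single h x : ActionAlgebra k H X) • v.1 = 0
    rw [smul_smul, single_mul_single, if_neg, zero_smul]
    rw [inv_smul_eq_iff]
    exact hx.symm

theorem fiberHom_fiberLoop {V W : FGModuleCat.{u} (ActionAlgebra k H X)} (f : V ⟶ W) (x : X)
    (h : H) (v : fiber V x) : fiberHom f x (fiberLoop V x h v) = fiberLoop W x h (fiberHom f x v) :=
  Subtype.ext <| by
    change f.hom.hom ((single 1 x : ActionAlgebra k H X) • (single h x : ActionAlgebra k H X) • v.1)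
      = (single 1 x : ActionAlgebra k H X) • (single h x : ActionAlgebra k H X) • f.hom.hom v.1
    rw [map_smul, map_smul]

/-! ### The regular module as a probe -/

section Regular

variable (k H X) in
/-- The action algebra as a module over itself. -/
abbrev regular : FGModuleCat.{u} (ActionAlgebra k H X) := FGModuleCat.of _ (ActionAlgebra k H X)

/-- The coefficient of `h ⊗ δ_x` in an element of the regular module. -/
def coeff (x y : X) (h : H) : fiber (regular k H X) x →ₗ[k] k where
  toFun a := (show ActionAlgebra k H X from a.1) h y
  map_add' _ _ := rfl
  map_smul' r a := by
    change (algebraMap k (ActionAlgebra k H X) r * (show ActionAlgebra k H X from a.1)) h y = _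
    rw [algebraMap_eq, ofFun_mul]
    rfl

/-- The element `δ_x` of the regular module. -/
def delta (k H : Type u) {X : Type u} [Field k] [Group H] [Fintype H] [MulAction H X] [Fintype X]
    (x : X) : fiber (regular k H X) x :=
  ⟨single 1 x, by
    change (single 1 x * single 1 x : ActionAlgebra k H X) = _
    rw [single_mul_single, if_pos (by simp), one_mul]⟩

theorem coeff_fiberMap {x y : X} (z : X) (g h : H) (hy : g • x = y)
    (a : fiber (regular k H X) x) :
    coeff y z h (fiberMap (regular k H X) g hy a) = coeff x z (g⁻¹ * h) a := by
  classical
  obtain ⟨a, ha⟩ := a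
  -- Lying in the fibre over `x` means that the coefficient at `(l, z)` vanishes unless `l z = x`;
  -- this makes the indicator in the product with `g ⊗ δ_x` redundant.
  have ha' : (single 1 x * (show ActionAlgebra k H X from a) : ActionAlgebra k H X) (g⁻¹ * h) z =
      (show ActionAlgebra k H X from a) (g⁻¹ * h) z := congrFun₂ (congrArg DFunLike.coe ha) _ _
  rw [single_eq_ofFun, ofFun_mul] at ha'
  change (single g x * (show ActionAlgebra k H X from a) : ActionAlgebra k H X) h z =
    (show ActionAlgebra k H X from a) (g⁻¹ * h) z
  rw [mul_apply, Finset.sum_eq_single (g⁻¹ * h), ← ha', single_apply]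
  · by_cases e : (g⁻¹ * h) • z = x <;> simp [e]
  · intro l _ hl
    rw [single_apply, if_neg, zero_mul]
    rintro ⟨rfl, -⟩
    simp at hl
  · simp

open Classical in
theorem coeff_delta (x z : X) (h : H) :
    coeff x z h (delta k H x) = if h = 1 ∧ z = x then 1 else 0 := rfl

open Classical in
theorem coeff_fiberLoop (x z : X) (g h : H) (a : fiber (regular k H X) x) :
    coeff x z h (fiberLoop (regular k H X) x g a) =
      if g • x = x then coeff x z (g⁻¹ * h) a else 0 := by
  split_ifs with hx
  · rw [fiberLoop_of_smul_eq _ hx, coeff_fiberMap]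
  · rw [fiberLoop_of_smul_ne _ hx]
    rfl

/-- The morphism from the regular module that sends the unit to `u`. -/
def fromRegular {U : FGModuleCat.{u} (ActionAlgebra k H X)} (u : U) : regular k H X ⟶ U :=
  FGModuleCat.ofHom (W := U) (LinearMap.toSpanSingleton (ActionAlgebra k H X) U u)

theorem fromRegular_delta {U : FGModuleCat.{u} (ActionAlgebra k H X)} {x : X} (u : fiber U x) :
    fiberHom (fromRegular u.1) x (delta k H x) = u :=
  Subtype.ext u.2

theorem smul_of_mem_fiber {U : FGModuleCat.{u} (ActionAlgebra k H X)} {x : X} {u : U}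
    (hu : u ∈ fiber U x) (a : ActionAlgebra k H X) :
    a • u = ∑ h, a h x • (single h x : ActionAlgebra k H X) • u := by
  conv_lhs => rw [eq_sum_single a]
  rw [Finset.sum_smul]
  refine Finset.sum_congr rfl fun h _ => ?_
  rw [Finset.sum_smul, Finset.sum_eq_single x, smul_assoc]
  · intro y _ hy
    rw [smul_assoc, single_smul_of_mem hu h hy, smul_zero]
  · simp

/-- The element acts on `u = δ_x u` and equals `δ_x a`. The right `δ_x` leaves only the coefficients
at `h ⊗ δ_x`, and the left one only those `h` that fix `x`. -/
theorem fiberHom_fromRegular {U : FGModuleCat.{u} (ActionAlgebra k H X)} {x : X} (u : fiber U x)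
    (a : fiber (regular k H X) x) :
    fiberHom (fromRegular u.1) x a = ∑ h, coeff x x h a • fiberLoop U x h u := by
  apply Subtype.ext
  have ha : single 1 x * (show ActionAlgebra k H X from a.1) = a.1 := a.2
  change (show ActionAlgebra k H X from a.1) • u.1 = _
  refine (congrArg (· • u.1) ha.symm).trans ((mul_smul _ _ _).trans ?_)
  rw [smul_of_mem_fiber u.2, Finset.smul_sum, Submodule.coe_sum]
  exact Finset.sum_congr rfl fun h _ => smul_comm_scalar _ _ _ _

theorem rTensor_fiberHom_fromRegular {U W : FGModuleCat.{u} (ActionAlgebra k H X)} {x : X}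
    (u : fiber U x) (t : fiber (regular k H X) x ⊗[k] fiber W x) :
    (fiberHom (fromRegular u.1) x).rTensor (fiber W x) t =
      ∑ h, fiberLoop U x h u ⊗ₜ TensorProduct.lid k _ ((coeff x x h).rTensor (fiber W x) t) := by
  induction t with
  | zero => simp
  | add s t hs ht => simp only [map_add, hs, ht, TensorProduct.tmul_add, Finset.sum_add_distrib]
  | tmul a w =>
    simp only [LinearMap.rTensor_tmul, fiberHom_fromRegular, TensorProduct.sum_tmul,
      TensorProduct.lid_tmul, TensorProduct.smul_tmul]

end Regular

/-! ### The projections defined by a half-braiding -/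

section Proj

variable {V : FGModuleCat.{u} (ActionAlgebra k H X)} (b : HalfBraiding V)

/-- The endomorphism of the fibre over `x` that is the coefficient at `h ∈ H` of a half-braiding
with the regular module. -/
def proj (x : X) (h : H) : fiber V x →ₗ[k] fiber V x :=
  (TensorProduct.lid k _).toLinearMap ∘ₗ (coeff x x h).rTensor _ ∘ₗ braid b (regular k H X) x ∘ₗ
    (TensorProduct.mk k _ _).flip (delta k H x)

/-- A half-braiding is determined by its coefficients. -/
theorem braid_tmul (U : FGModuleCat.{u} (ActionAlgebra k H X)) (x : X) (v : fiber V x)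
    (u : fiber U x) : braid b U x (v ⊗ₜ u) = ∑ h, fiberLoop U x h u ⊗ₜ proj b x h v := by
  -- Naturality along the morphism from the regular module that sends `δ_x` to `u`.
  conv_lhs => rw [← fromRegular_delta u]
  rw [braid_fiberHom, rTensor_fiberHom_fromRegular]
  rfl

-- The vectors `g δ_x` and the coefficients at `h ⊗ δ_x` are dual over the stabilizer, so a
-- coefficient picks a single term of `braid_tmul`.
open Classical in
theorem coeff_fiberLoop_delta {x : X} {h : H} (hx : h • x = x) (g : H) :
    coeff x x h (fiberLoop (regular k H X) x g (delta k H x)) = if g = h then 1 else 0 := by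
  rw [coeff_fiberLoop, coeff_delta]
  by_cases e : g = h
  · subst e
    simp [hx]
  · simp [e, inv_mul_eq_one]

/-- By `braid_tmul` for the regular module itself, only vectors `g δ_x` with `g` fixing `x` occur,
and these have no coefficient at `h`. -/
theorem proj_of_smul_ne {x : X} {h : H} (hx : h • x ≠ x) : proj b x h = 0 := by
  classical
  ext v : 1
  refine (congrArg (fun t => TensorProduct.lid k _ ((coeff x x h).rTensor _ t))
    (braid_tmul b (regular k H X) x v (delta k H x))).trans ?_
  simp only [map_sum, LinearMap.rTensor_tmul, TensorProduct.lid_tmul]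
  refine Finset.sum_eq_zero fun g _ => ?_
  rw [coeff_fiberLoop, coeff_delta]
  split_ifs with h₁ h₂
  · exact absurd (inv_mul_eq_one.1 h₂.1 ▸ h₁) hx
  · exact zero_smul _ _
  · exact zero_smul _ _

theorem proj_fiberMap {g : H} {x y : X} (hy : g • x = y) (h : H) (v : fiber V x) :
    proj b y (g * h * g⁻¹) (fiberMap V g hy v) = fiberMap V g hy (proj b x h v) := by
  classical
  have hgy : g⁻¹ • y = x := by rw [← hy, inv_smul_smul]
  by_cases hx : h • x = x
  · have hx' : (g * h * g⁻¹) • y = y := by simp only [mul_smul, hgy, hx, hy]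
    -- Equivariance on `v ⊗ δ_x`, read at the coefficient of `g h ⊗ δ_x`. One side has terms `l g
    -- δ_x ⊗ p_l (g v)`, the other `g l δ_x ⊗ g p_l v`, which selects `l = g h g⁻¹` and `l = h`.
    have key := congrArg (fun t => TensorProduct.lid k _ ((coeff y x (g * h)).rTensor _ t))
      (braid_fiberMap b (regular k H X) hy v (delta k H x))
    simp only [braid_tmul, map_sum, LinearMap.rTensor_tmul, TensorProduct.lid_tmul,
      TensorProduct.map_tmul, coeff_fiberMap, inv_mul_cancel_left, coeff_fiberLoop_delta hx,
      ite_smul, one_smul, zero_smul, Finset.sum_ite_eq', Finset.mem_univ, if_true] at key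
    rw [← key, Finset.sum_eq_single (g * h * g⁻¹)]
    · rw [coeff_fiberLoop, if_pos hx', coeff_fiberMap, coeff_delta, if_pos, one_smul]
      exact ⟨by group, rfl⟩
    · intro l _ hl
      have hne : ¬ (g⁻¹ * (l⁻¹ * (g * h)) = 1 ∧ x = x) := by
        rintro ⟨e, -⟩
        rw [inv_mul_eq_one, eq_inv_mul_iff_mul_eq] at e
        exact hl (eq_mul_inv_iff_mul_eq.2 e)
      rw [coeff_fiberLoop, coeff_fiberMap, coeff_delta, if_neg hne, ite_self]
      exact zero_smul _ _
    · simp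
  · rw [proj_of_smul_ne b hx, proj_of_smul_ne b]
    · simp
    · simpa only [mul_smul, hgy, ← hy, ne_eq, smul_left_cancel_iff, inv_smul_smul] using hx

theorem fiberTensor_fiberLoop (U U' : FGModuleCat.{u} (ActionAlgebra k H X)) (x : X) (h : H)
    (u : fiber U x) (u' : fiber U' x) :
    fiberTensor U U' x (fiberLoop U x h u ⊗ₜ fiberLoop U' x h u') =
      fiberLoop (U ⊗ U') x h (fiberTensor U U' x (u ⊗ₜ u')) := by
  by_cases hx : h • x = x
  · simp only [fiberLoop_of_smul_eq _ hx, fiberTensor_fiberMap]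
  · simp [fiberLoop_of_smul_ne _ hx]

-- Compare coefficients in the hexagon for two copies of the regular module, on `v ⊗ δ_x ⊗ δ_x`.
-- Braiding with the tensor product gives the diagonal sum of `l δ_x ⊗ l δ_x ⊗ p_l v`, since the
-- group acts diagonally; braiding twice gives the double sum of `l δ_x ⊗ m δ_x ⊗ p_m p_l v`.
open Classical in
theorem proj_proj (x : X) (g h : H) (v : fiber V x) :
    proj b x g (proj b x h v) = if g = h then proj b x h v else 0 := by
  by_cases hh : h • x = x
  swap
  · simp [proj_of_smul_ne b hh]
  by_cases hg : g • x = x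
  swap
  · rw [proj_of_smul_ne b hg, if_neg (fun e : g = h => hg (e ▸ hh))]
    rfl
  have key := congrArg (fun t => TensorProduct.lid k _ ((coeff x x g).rTensor _
      (TensorProduct.lid k _ ((coeff x x h).rTensor _ (TensorProduct.assoc k _ _ _ t)))))
    (braid_tensor b (regular k H X) (regular k H X) x v (delta k H x) (delta k H x))
  simp only [braid_tmul, map_sum, ← fiberTensor_fiberLoop, LinearMap.rTensor_tmul,
    LinearEquiv.coe_coe, LinearEquiv.symm_apply_apply, TensorProduct.lid_tmul,
    TensorProduct.sum_tmul, TensorProduct.assoc_tmul, LinearMap.lTensor_tmul,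
    TensorProduct.tmul_sum, TensorProduct.assoc_symm_tmul, map_smul] at key
  simp only [coeff_fiberLoop_delta hh, coeff_fiberLoop_delta hg, ite_smul, one_smul, zero_smul,
    Finset.sum_ite_eq', Finset.mem_univ, if_true] at key
  rw [Finset.sum_comm] at key
  simp only [Finset.sum_ite_eq', Finset.mem_univ, if_true] at key
  rw [← key]
  simp only [eq_comm]

/-- No vector but zero is killed by all projections, because the half-braiding is injective; by
orthogonality `v - ∑ p_h v` is killed by all of them. -/
theorem sum_proj (x : X) (v : fiber V x) : ∑ h, proj b x h v = v := by
  classical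
  have inj : ∀ v : fiber V x, (∀ h, proj b x h v = 0) → v = 0 := by
    intro v hv
    have h0 : v ⊗ₜ[k] delta k H x = 0 := by
      apply braid_injective b (regular k H X) x
      rw [braid_tmul, map_zero]
      exact Finset.sum_eq_zero fun h _ => by rw [hv, TensorProduct.tmul_zero]
    have := congrArg (fun t => TensorProduct.rid k _ ((coeff x x 1).lTensor _ t)) h0
    have h1 : coeff x x 1 (delta k H x) = 1 := by
      change (single 1 x : ActionAlgebra k H X) 1 x = 1
      simp [single_apply]
    simpa [h1] using this
  refine (sub_eq_zero.1 (inj _ fun g => ?_)).symm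
  rw [map_sub, map_sum]
  simp [proj_proj]

theorem fiberHom_lid_rTensor_coeff {V W : FGModuleCat.{u} (ActionAlgebra k H X)} (f : V ⟶ W)
    (x : X) (h : H) (t : fiber (regular k H X) x ⊗[k] fiber V x) :
    fiberHom f x (TensorProduct.lid k _ ((coeff x x h).rTensor _ t)) =
      TensorProduct.lid k _ ((coeff x x h).rTensor _ ((fiberHom f x).lTensor _ t)) := by
  induction t with
  | zero => simp
  | add s t hs ht => simp only [map_add, hs, ht]
  | tmul a w => simp

/-- The projections are coefficients of the half-braiding and determine it through `braid_tmul`, so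
commuting with one is commuting with the other. -/
theorem center_comm_iff_proj {A B : Center (FGModuleCat.{u} (ActionAlgebra k H X))}
    (f : A.1 ⟶ B.1) :
    (∀ U, f ▷ U ≫ (B.2.β U).hom = (A.2.β U).hom ≫ U ◁ f) ↔
      ∀ x h (v : fiber A.1 x),
        fiberHom f x (proj A.2 x h v) = proj B.2 x h (fiberHom f x v) := by
  rw [center_comm_iff]
  constructor
  · intro hf x h v
    exact (fiberHom_lid_rTensor_coeff f x h _).trans
      (congrArg (fun t => TensorProduct.lid k _ ((coeff x x h).rTensor _ t)) (hf _ x v _).symm)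
  · intro hf U x v u
    simp only [braid_tmul, map_sum, LinearMap.lTensor_tmul, hf]

end Proj

end ActionAlgebra

/-! ### From gradings back to half-braidings -/

namespace ActionAlgebra

open scoped ModuleCat TensorProduct
open Functor.LaxMonoidal Functor.OplaxMonoidal

variable {k H X : Type u} [Field k] [Group H] [Fintype H] [MulAction H X] [Fintype X]

open Classical in
/-- An equivariant grading of the fibres of a module by the stabilizers of the points, given by
the projections to the homogeneous components. -/
@[ext]
structure StabilizerGrading (V : FGModuleCat.{u} (ActionAlgebra k H X)) where
  /-- The projection to the component of `h` in the fibre over `x`. -/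
  proj (x : X) (h : H) : fiber V x →ₗ[k] fiber V x
  proj_of_smul_ne {x : X} {h : H} (hx : h • x ≠ x) : proj x h = 0
  proj_fiberMap {g : H} {x y : X} (hy : g • x = y) (h : H) (v : fiber V x) :
    proj y (g * h * g⁻¹) (fiberMap V g hy v) = fiberMap V g hy (proj x h v)
  proj_proj (x : X) (g h : H) (v : fiber V x) :
    proj x g (proj x h v) = if g = h then proj x h v else 0
  sum_proj (x : X) (v : fiber V x) : ∑ h, proj x h v = v

/-- The grading defined by a half-braiding. -/
def grading {V : FGModuleCat.{u} (ActionAlgebra k H X)} (b : HalfBraiding V) :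
    StabilizerGrading V where
  proj := proj b
  proj_of_smul_ne := proj_of_smul_ne b
  proj_fiberMap := proj_fiberMap b
  proj_proj := proj_proj b
  sum_proj := sum_proj b

theorem fiberLoop_fiberLoop_inv (U : FGModuleCat.{u} (ActionAlgebra k H X)) {x : X} {h : H}
    (hx : h • x = x) (u : fiber U x) : fiberLoop U x h (fiberLoop U x h⁻¹ u) = u := by
  have hx' : h⁻¹ • x = x := inv_smul_eq_iff.2 hx.symm
  rw [fiberLoop_of_smul_eq _ hx, fiberLoop_of_smul_eq _ hx']
  apply Subtype.ext
  change (single h x : ActionAlgebra k H X) • (single h⁻¹ x : ActionAlgebra k H X) • u.1 = u.1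
  rw [smul_single_smul _ _ _ _ hx', mul_inv_cancel, mem_fiber.1 u.2]

theorem fiberLoop_inv_fiberLoop (U : FGModuleCat.{u} (ActionAlgebra k H X)) {x : X} {h : H}
    (hx : h • x = x) (u : fiber U x) : fiberLoop U x h⁻¹ (fiberLoop U x h u) = u := by
  have := fiberLoop_fiberLoop_inv U (inv_smul_eq_iff.2 hx.symm) u
  rwa [inv_inv] at this

theorem fiberLoop_fiberMap (U : FGModuleCat.{u} (ActionAlgebra k H X)) {g : H} {x y : X}
    (hy : g • x = y) (h : H) (u : fiber U x) :
    fiberLoop U y (g * h * g⁻¹) (fiberMap U g hy u) = fiberMap U g hy (fiberLoop U x h u) := by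
  have hgy : g⁻¹ • y = x := by rw [← hy, inv_smul_smul]
  by_cases hx : h • x = x
  · have hx' : (g * h * g⁻¹) • y = y := by simp only [mul_smul, hgy, hx, hy]
    rw [fiberLoop_of_smul_eq _ hx, fiberLoop_of_smul_eq _ hx']
    apply Subtype.ext
    change (single _ _ : ActionAlgebra k H X) • (single _ _ : ActionAlgebra k H X) • u.1 =
      (single _ _ : ActionAlgebra k H X) • (single _ _ : ActionAlgebra k H X) • u.1
    rw [smul_single_smul _ _ _ _ hy, smul_single_smul _ _ _ _ hx, inv_mul_cancel_right]
  · rw [fiberLoop_of_smul_ne _ hx, fiberLoop_of_smul_ne]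
    · simp
    · simpa only [mul_smul, hgy, ← hy, ne_eq, smul_left_cancel_iff, inv_smul_smul] using hx

namespace StabilizerGrading

variable {V : FGModuleCat.{u} (ActionAlgebra k H X)} (D : StabilizerGrading V)

theorem proj_proj_self (x : X) (h : H) (v : fiber V x) :
    D.proj x h (D.proj x h v) = D.proj x h v := by
  rw [D.proj_proj, if_pos rfl]

theorem proj_proj_of_ne (x : X) {g h : H} (hgh : g ≠ h) (v : fiber V x) :
    D.proj x g (D.proj x h v) = 0 := by
  rw [D.proj_proj, if_neg hgh]

/-- The half-braiding `v ⊗ u ↦ ∑ h u ⊗ v_h` in the fibre over `x`. -/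
def braid (U : FGModuleCat.{u} (ActionAlgebra k H X)) (x : X) :
    fiber V x ⊗[k] fiber U x ≃ₗ[k] fiber U x ⊗[k] fiber V x :=
  LinearEquiv.ofLinearMap
    ((∑ h, TensorProduct.map (fiberLoop U x h) (D.proj x h)) ∘ₗ
      (TensorProduct.comm k _ _).toLinearMap)
    -- The inverse is `u ⊗ v ↦ ∑ v_h ⊗ h⁻¹ u`. Outside the stabilizer `fiberLoop` is not invertible,
    -- but there `v_h` vanishes.
    ((∑ h, TensorProduct.map (D.proj x h) (fiberLoop U x h⁻¹)) ∘ₗ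
      (TensorProduct.comm k _ _).toLinearMap)
    (TensorProduct.ext' fun u v => by
      simp only [LinearMap.comp_apply, LinearEquiv.coe_coe, TensorProduct.comm_tmul,
        LinearMap.sum_apply, TensorProduct.map_tmul, map_sum, LinearMap.id_apply]
      conv_rhs => rw [← D.sum_proj x v, TensorProduct.tmul_sum]
      refine Finset.sum_congr rfl fun h _ => ?_
      rw [Finset.sum_eq_single h]
      · rw [proj_proj_self]
        by_cases hx : h • x = x
        · rw [fiberLoop_fiberLoop_inv U hx]
        · rw [D.proj_of_smul_ne hx]
          simp
      · intro g _ hg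
        rw [D.proj_proj_of_ne _ hg, TensorProduct.tmul_zero]
      · simp)
    (TensorProduct.ext' fun v u => by
      simp only [LinearMap.comp_apply, LinearEquiv.coe_coe, TensorProduct.comm_tmul,
        LinearMap.sum_apply, TensorProduct.map_tmul, map_sum, LinearMap.id_apply]
      conv_rhs => rw [← D.sum_proj x v, TensorProduct.sum_tmul]
      refine Finset.sum_congr rfl fun h _ => ?_
      rw [Finset.sum_eq_single h]
      · rw [proj_proj_self]
        by_cases hx : h • x = x
        · rw [fiberLoop_inv_fiberLoop U hx]
        · rw [D.proj_of_smul_ne hx]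
          simp
      · intro g _ hg
        rw [D.proj_proj_of_ne _ hg, TensorProduct.zero_tmul]
      · simp)

theorem braid_tmul (U : FGModuleCat.{u} (ActionAlgebra k H X)) (x : X) (v : fiber V x)
    (u : fiber U x) : D.braid U x (v ⊗ₜ u) = ∑ h, fiberLoop U x h u ⊗ₜ D.proj x h v := by
  simp [braid]

/-- The half-braiding `v ⊗ u ↦ ∑ h u ⊗ v_h` as an isomorphism of bundles. -/
def braidIso (U : FGModuleCat.{u} (ActionAlgebra k H X)) :
    (toBundle k H X).obj V ⊗ (toBundle k H X).obj U ≅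
      (toBundle k H X).obj U ⊗ (toBundle k H X).obj V :=
  NatIso.ofComponents (fun p => (D.braid U p.back).toFGModuleCatIso) fun {p q} f =>
    FGModuleCat.hom_ext <| TensorProduct.ext' (M := fiber V p.back) (N := fiber U p.back)
      fun v u => by
        change D.braid U q.back (fiberMap V (label f) (label_smul f) v ⊗ₜ
          fiberMap U (label f) (label_smul f) u) = TensorProduct.map
            (fiberMap U (label f) (label_smul f)) (fiberMap V (label f) (label_smul f))
              (D.braid U p.back (v ⊗ₜ u))
        simp only [braid_tmul, map_sum, TensorProduct.map_tmul]
        -- The group element of `f` moves the component of `h` to that of its conjugate, so the sum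
        -- is reindexed by conjugation.
        rw [← Equiv.sum_comp (MulAut.conj (label f)).toEquiv]
        refine Finset.sum_congr rfl fun h _ => ?_
        change fiberLoop U _ (label f * h * (label f)⁻¹) _ ⊗ₜ
          D.proj _ (label f * h * (label f)⁻¹) _ = _
        rw [fiberLoop_fiberMap, D.proj_fiberMap]

/-- The hexagon: orthogonality of the projections reduces the double sum of two successive braidings
to its diagonal, where `h` acts on both factors. -/
theorem braid_fiberTensor (U U' : FGModuleCat.{u} (ActionAlgebra k H X)) (x : X) (v : fiber V x)
    (t : fiber U x ⊗[k] fiber U' x) :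
    (fiberTensor U U' x).symm.toLinearMap.rTensor _
        (D.braid (U ⊗ U') x (v ⊗ₜ fiberTensor U U' x t)) =
      (TensorProduct.assoc k _ _ _).symm ((D.braid U' x).toLinearMap.lTensor _
        (TensorProduct.assoc k _ _ _ ((D.braid U x).toLinearMap.rTensor _
          ((TensorProduct.assoc k _ _ _).symm (v ⊗ₜ t))))) := by
  induction t with
  | zero => simp
  | add s t hs ht => simp only [map_add, TensorProduct.tmul_add, hs, ht]
  | tmul u u' =>
    simp only [braid_tmul, map_sum, ← fiberTensor_fiberLoop, LinearMap.rTensor_tmul,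
      LinearEquiv.coe_coe, LinearEquiv.symm_apply_apply, TensorProduct.sum_tmul,
      TensorProduct.assoc_tmul, LinearMap.lTensor_tmul, TensorProduct.tmul_sum,
      TensorProduct.assoc_symm_tmul]
    refine Finset.sum_congr rfl fun h _ => ?_
    rw [Finset.sum_eq_single h]
    · rw [proj_proj_self]
    · intro g _ hg
      rw [D.proj_proj_of_ne _ hg, TensorProduct.tmul_zero]
    · simp

/-- The half-braiding defined by a grading. -/
def halfBraiding : HalfBraiding V :=
  HalfBraiding.ofImage (toBundle k H X) D.braidIso
    (fun {U U'} f => NatTrans.ext <| funext fun p => FGModuleCat.hom_ext <|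
      TensorProduct.ext' (M := fiber V p.back) (N := fiber U p.back) fun v u => by
        change D.braid U' p.back (v ⊗ₜ fiberHom f p.back u) =
          (fiberHom f p.back).rTensor _ (D.braid U p.back (v ⊗ₜ u))
        simp only [braid_tmul, map_sum, LinearMap.rTensor_tmul, fiberHom_fiberLoop])
    (fun U U' => NatTrans.ext <| funext fun p => FGModuleCat.hom_ext <|
      TensorProduct.ext' (M := fiber V p.back) (N := fiber U p.back ⊗[k] fiber U' p.back)
        fun v t => D.braid_fiberTensor U U' p.back v t)

/-- Every grading comes from a half-braiding; essential surjectivity of `centerToInertia` rests on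
this. -/
theorem proj_halfBraiding (x : X) (h : H) : ActionAlgebra.proj D.halfBraiding x h = D.proj x h := by
  classical
  by_cases hx : h • x = x
  swap
  · rw [ActionAlgebra.proj_of_smul_ne _ hx, D.proj_of_smul_ne hx]
  ext v : 1
  have hb : ActionAlgebra.braid D.halfBraiding (regular k H X) x = D.braid (regular k H X) x :=
    congrArg (fun g => (g.app (pt H x)).hom.hom)
      (HalfBraiding.image_ofImage D.braidIso _ _ (regular k H X))
  change TensorProduct.lid k _ ((coeff x x h).rTensor _
    (ActionAlgebra.braid D.halfBraiding (regular k H X) x (v ⊗ₜ delta k H x))) = _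
  rw [hb]
  change TensorProduct.lid k _ ((coeff x x h).rTensor _
    (D.braid (regular k H X) x (v ⊗ₜ delta k H x))) = _
  simp only [braid_tmul, map_sum, LinearMap.rTensor_tmul, TensorProduct.lid_tmul,
    coeff_fiberLoop_delta hx, ite_smul, one_smul, zero_smul, Finset.sum_ite_eq', Finset.mem_univ,
    if_true]

end StabilizerGrading

end ActionAlgebra

/-! ### Representations of action algebras -/

namespace ActionAlgebra

section Lift

variable {k H Y : Type*} [Field k] [Group H] [Fintype H] [MulAction H Y]

variable (k Y) in
open Classical in
/-- The element `h ⊗ 1` of the action algebra. -/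
def ofGroup (h : H) : ActionAlgebra k H Y := .mk fun g _ => if g = h then 1 else 0

open Classical in
theorem ofGroup_apply (h g : H) (y : Y) : ofGroup k Y h g y = if g = h then 1 else 0 := rfl

theorem ofGroup_one : ofGroup k Y (1 : H) = 1 := rfl

theorem ofGroup_mul_ofGroup (g h : H) : ofGroup k Y g * ofGroup k Y h = ofGroup k Y (g * h) := by
  classical
  ext l y
  rw [mul_apply, Finset.sum_eq_single h]
  · simp [ofGroup_apply, mul_inv_eq_iff_eq_mul]
  · intro m _ hm
    simp [ofGroup_apply, hm]
  · simp

theorem ofGroup_mul_single (g h : H) (y : Y) :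
    ofGroup k Y g * single h y = single (g * h) y := by
  classical
  ext l z
  rw [mul_apply, Finset.sum_eq_single h]
  · simp [ofGroup_apply, single_apply, mul_inv_eq_iff_eq_mul, ← ite_and, and_comm]
  · intro m _ hm
    simp [single_apply, hm]
  · simp

theorem single_mul_ofGroup (g : H) (y : Y) :
    single 1 (g • y) * ofGroup k Y g = single g y := by
  classical
  ext l z
  rw [mul_apply, Finset.sum_eq_single g]
  · simp [ofGroup_apply, single_apply, mul_inv_eq_one]
  · intro m _ hm
    simp [ofGroup_apply, hm]
  · simp

variable {E : Type*} [AddCommGroup E] [Module k E]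

open Classical in
/-- The representation of the action algebra given by a representation of the group and a
compatible complete family of orthogonal idempotents. -/
def lift [Fintype Y] (T : H →* Module.End k E) (P : Y → Module.End k E)
    (hPT : ∀ h y, P (h • y) * T h = T h * P y)
    (hPP : ∀ y z, P y * P z = if y = z then P z else 0) (hP : ∑ y, P y = 1) :
    ActionAlgebra k H Y →ₐ[k] Module.End k E :=
  let φ : ActionAlgebra k H Y →ₗ[k] Module.End k E :=
    { toFun := fun a => ∑ h, ∑ y, a h y • (T h * P y)
      map_add' := fun a b => by simp only [add_apply, add_smul, Finset.sum_add_distrib]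
      map_smul' := fun r a => by
        simp only [smul_apply, mul_smul, Finset.smul_sum, RingHom.id_apply] }
  have hφ : ∀ h y, φ (single h y) = T h * P y := fun h y => by
    change ∑ g, ∑ z, (single h y : ActionAlgebra k H Y) g z • (T g * P z) = _
    rw [Finset.sum_eq_single h, Finset.sum_eq_single y]
    · simp [single_apply]
    · intro z _ hz; simp [single_apply, hz]
    · simp
    · intro g _ hg; simp [single_apply, hg]
    · simp
  AlgHom.ofLinearMap φ
    (by
      rw [← sum_single_one, map_sum, ← hP]
      exact Finset.sum_congr rfl fun y _ => by rw [hφ, map_one, one_mul])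
    (fun a b => by
      rw [eq_sum_single a, eq_sum_single b]
      simp only [Finset.sum_mul, Finset.mul_sum, map_sum, smul_mul_smul_comm, map_smul]
      refine Finset.sum_congr rfl fun g _ => Finset.sum_congr rfl fun z _ =>
        Finset.sum_congr rfl fun h _ => Finset.sum_congr rfl fun y _ => congrArg _ ?_
      -- This is the relation that moves idempotents past group elements in `single_mul_single`.
      have e : P y * T g = T g * P (g⁻¹ • y) := by rw [← hPT, smul_inv_smul]
      rw [hφ, hφ, single_mul_single, mul_assoc, ← mul_assoc (P y), e, mul_assoc (T g), hPP,
        ← mul_assoc, ← map_mul]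
      split_ifs
      · exact hφ _ _
      · rw [map_zero, mul_zero])

theorem lift_single [Fintype Y] (T : H →* Module.End k E) (P : Y → Module.End k E) (hPT) (hPP)
    (hP) (h : H) (y : Y) : lift T P hPT hPP hP (single h y) = T h * P y := by
  classical
  change ∑ g, ∑ z, (single h y : ActionAlgebra k H Y) g z • (T g * P z) = _
  rw [Finset.sum_eq_single h, Finset.sum_eq_single y]
  · simp [single_apply]
  · intro z _ hz; simp [single_apply, hz]
  · simp
  · intro g _ hg; simp [single_apply, hg]
  · simp

end Lift

open scoped ModuleCat TensorProduct

variable {k H X : Type u} [Field k] [Group H] [Fintype H] [MulAction H X] [Fintype X]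

theorem algHom_ext {R : Type*} [Semiring R] [Algebra k R] {f g : ActionAlgebra k H X →ₐ[k] R}
    (h : ∀ h x, f (single h x) = g (single h x)) : f = g :=
  AlgHom.ext fun a => by
    rw [eq_sum_single a]
    simp only [map_sum, map_smul, h]

/-- The projection of a module to its fibre over `x`. -/
def fiberProj (V : FGModuleCat.{u} (ActionAlgebra k H X)) (x : X) : V →ₗ[k] fiber V x where
  toFun v := ⟨(single 1 x : ActionAlgebra k H X) • v, single_smul_mem V (one_smul H x) v⟩
  map_add' v w := Subtype.ext (smul_add _ v w)
  map_smul' r v := Subtype.ext (smul_comm_scalar V _ r v)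

theorem fiberProj_coe {V : FGModuleCat.{u} (ActionAlgebra k H X)} {x : X} (v : fiber V x) :
    fiberProj V x v = v := Subtype.ext v.2

theorem fiberProj_coe_of_ne {V : FGModuleCat.{u} (ActionAlgebra k H X)} {x y : X} (hy : y ≠ x)
    (v : fiber V x) : fiberProj V y v = 0 := Subtype.ext (single_smul_of_mem v.2 1 hy)

theorem fiberProj_ofGroup_smul (V : FGModuleCat.{u} (ActionAlgebra k H X)) (h : H) (x : X) (v : V) :
    fiberProj V (h • x) (ofGroup k X h • v) = fiberMap V h rfl (fiberProj V x v) :=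
  Subtype.ext <| by
    change (single 1 (h • x) : ActionAlgebra k H X) • _ • v =
      (single h x : ActionAlgebra k H X) • (single 1 x : ActionAlgebra k H X) • v
    rw [smul_smul, single_mul_ofGroup, smul_single_smul _ _ _ _ (one_smul H x), mul_one]

theorem ofGroup_smul_coe (V : FGModuleCat.{u} (ActionAlgebra k H X)) (h : H) (x : X)
    (v : fiber V x) : ofGroup k X h • v.1 = fiberMap V h rfl v := by
  change _ = (single h x : ActionAlgebra k H X) • v.1
  conv_lhs => rw [← mem_fiber.1 v.2, smul_smul, ofGroup_mul_single, mul_one]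

/-! ### Gradings as actions of the inertia algebra -/

namespace StabilizerGrading

variable {V : FGModuleCat.{u} (ActionAlgebra k H X)} (D : StabilizerGrading V)

/-- The projection of a module to a component of a grading. -/
def component (ω : Inertia H X) : Module.End k V :=
  (fiber V ω.base).subtype ∘ₗ D.proj ω.base ω.loop ∘ₗ fiberProj V ω.base

theorem component_apply (ω : Inertia H X) (v : V) :
    D.component ω v = D.proj ω.base ω.loop (fiberProj V ω.base v) := rfl

theorem sum_component : ∑ ω, D.component ω = 1 := by
  ext v
  rw [LinearMap.sum_apply]
  -- The sum is extended to all pairs in `X × H`; the added terms vanish since projections outside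
  -- the stabilizer are zero.
  refine (Fintype.sum_of_injective (fun ω : Inertia H X => ω.1) Subtype.val_injective _
    (fun p : X × H => ((D.proj p.1 p.2 (fiberProj V p.1 v) : fiber V p.1) : V)) ?_ ?_).trans ?_
  · intro p hp
    rw [D.proj_of_smul_ne fun h => hp ⟨⟨p, h⟩, rfl⟩]
    rfl
  · exact fun _ => rfl
  · rw [Fintype.sum_prod_type]
    have h (x : X) : ∑ h, ((D.proj x h (fiberProj V x v) : fiber V x) : V) =
        (single 1 x : ActionAlgebra k H X) • v := by
      rw [← Submodule.coe_sum, D.sum_proj]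
      rfl
    refine (Finset.sum_congr rfl fun x _ => h x).trans ?_
    rw [← Finset.sum_smul, sum_single_one, one_smul]
    rfl

-- Equality of the base points is kept as a hypothesis because the fibres depend on them and it has
-- to be substituted.
open Classical in
theorem proj_fiberProj_proj {x y : X} (e : x = y) (g h : H) (v : fiber V y) :
    ((D.proj x g (fiberProj V x (D.proj y h v)) : fiber V x) : V) =
      if g = h then D.proj y h v else 0 := by
  subst e
  rw [fiberProj_coe, D.proj_proj]

open Classical in
theorem component_mul_component (ω ω' : Inertia H X) :
    D.component ω * D.component ω' = if ω = ω' then D.component ω' else 0 := by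
  ext v
  rw [Module.End.mul_apply, component_apply, component_apply]
  by_cases hb : ω.base = ω'.base
  · rw [D.proj_fiberProj_proj hb]
    by_cases hl : ω.loop = ω'.loop
    · rw [if_pos hl, if_pos (Inertia.ext hb hl)]
      rfl
    · rw [if_neg hl, if_neg fun h => hl (congrArg Inertia.loop h)]
      rfl
  · rw [fiberProj_coe_of_ne hb, if_neg fun h => hb (congrArg Inertia.base h)]
    simp

/-- The action of the action algebra of the inertia set that is defined by a grading. -/
def action : ActionAlgebra k H (Inertia H X) →ₐ[k] Module.End k V :=
  lift
    { toFun := fun h => Algebra.lsmul k k V (ofGroup k X h)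
      map_one' := by rw [ofGroup_one, map_one]
      map_mul' := fun g h => by rw [← ofGroup_mul_ofGroup, map_mul] }
    D.component
    (fun h ω => LinearMap.ext fun v => by
      change ((D.proj (h • ω.base) (h * ω.loop * h⁻¹)
        (fiberProj V (h • ω.base) (ofGroup k X h • v)) : fiber V _) : V) =
          ofGroup k X h • ((D.proj ω.base ω.loop (fiberProj V ω.base v) : fiber V _) : V)
      rw [fiberProj_ofGroup_smul, D.proj_fiberMap, ofGroup_smul_coe])
    D.component_mul_component
    D.sum_component

theorem action_single (h : H) (ω : Inertia H X) (v : V) :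
    D.action (single h ω) v = ofGroup k X h • D.component ω v := by
  rw [action, lift_single]
  rfl

open Classical in
theorem component_single_one_smul (ω : Inertia H X) (x : X) (v : V) :
    D.component ω ((single 1 x : ActionAlgebra k H X) • v) =
      if ω.base = x then D.component ω v else 0 := by
  change ((D.proj ω.base ω.loop (fiberProj V ω.base (fiberProj V x v).1) : fiber V _) : V) = _
  split_ifs with hx
  · subst hx
    rw [fiberProj_coe]
    rfl
  · rw [fiberProj_coe_of_ne hx, map_zero]
    rfl

/-- The action of the action algebra of the inertia set extends that of the action algebra. -/
theorem action_comap : D.action.comp (comap k Inertia.base fun _ _ => rfl) =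
    Algebra.lsmul k k V := by
  classical
  refine algHom_ext fun h x => LinearMap.ext fun v => ?_
  -- The function `δ_x` pulls back to the sum of `δ_ω` over all `ω` above `x`.
  have e : comap k (Inertia.base (H := H)) (fun _ _ => rfl) (single h x : ActionAlgebra k H X) =
      ∑ ω, if ω.base = x then single h ω else 0 := by
    ext g ω
    rw [sum_apply, Finset.sum_eq_single ω]
    · change (single h x : ActionAlgebra k H X) g ω.base = _
      split_ifs with hx <;> simp [single_apply, hx]
    · intro ω' _ hω
      split_ifs with hx
      · simp [single_apply, hω.symm]
      · rfl
    · simp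
  change D.action (comap k Inertia.base (fun _ _ => rfl) (single h x)) v =
    (single h x : ActionAlgebra k H X) • v
  have hx : (single h x : ActionAlgebra k H X) = ofGroup k X h * single 1 x := by
    rw [ofGroup_mul_single, mul_one]
  have hv := LinearMap.congr_fun D.sum_component ((single 1 x : ActionAlgebra k H X) • v)
  rw [LinearMap.sum_apply, Module.End.one_apply] at hv
  rw [e, map_sum, LinearMap.sum_apply, hx, mul_smul, ← hv, Finset.smul_sum]
  refine Finset.sum_congr rfl fun ω _ => ?_
  rw [component_single_one_smul]
  split_ifs
  · rw [action_single]
  · rw [map_zero, smul_zero]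
    rfl

theorem comap_smul (a : ActionAlgebra k H X) (v : V) :
    D.action (comap k Inertia.base (fun _ _ => rfl) a) v = a • v :=
  congrArg (fun f => f a v) D.action_comap

/-- The module over the action algebra of the inertia set that is defined by a grading. -/
def Total (_ : StabilizerGrading V) : Type u := V

instance : AddCommGroup D.Total := inferInstanceAs (AddCommGroup V)

instance : Module (ActionAlgebra k H (Inertia H X)) D.Total :=
  Module.compHom V D.action.toRingHom

instance : Module.Finite (ActionAlgebra k H (Inertia H X)) D.Total :=
  Module.Finite.of_surjective
    (σ := (comap k (Inertia.base (H := H) (X := X)) fun _ _ => rfl).toRingHom)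
    ({ AddMonoidHom.id V with
      map_smul' := fun a v => (D.comap_smul a v).symm } : V →ₛₗ[_] D.Total) Function.surjective_id

end StabilizerGrading

/-- A morphism of modules that is compatible with gradings is a morphism of modules over the action
algebra of the inertia set. -/
theorem StabilizerGrading.map_action {V W : FGModuleCat.{u} (ActionAlgebra k H X)}
    (D : StabilizerGrading V) (D' : StabilizerGrading W) (f : V ⟶ W)
    (hf : ∀ x h v, fiberHom f x (D.proj x h v) = D'.proj x h (fiberHom f x v))
    (a : ActionAlgebra k H (Inertia H X)) (v : V) :
    f.hom.hom (D.action a v) = D'.action a (f.hom.hom v) := by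
  have hk (r : k) (v : V) : f.hom.hom (r • v) = r • f.hom.hom v :=
    f.hom.hom.map_smul (algebraMap k _ r) v
  have hc (ω : Inertia H X) : f.hom.hom (D.component ω v) = D'.component ω (f.hom.hom v) := by
    refine (congrArg Subtype.val (hf ω.base ω.loop (fiberProj V ω.base v))).trans ?_
    refine congrArg (fun w => (D'.proj ω.base ω.loop w).1) (Subtype.ext ?_)
    exact f.hom.hom.map_smul _ v
  rw [eq_sum_single a]
  simp only [map_sum, map_smul, LinearMap.sum_apply, LinearMap.smul_apply, hk, action_single, hc]

/-- A morphism of modules over the action algebra of the inertia set is compatible with the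
gradings. -/
theorem StabilizerGrading.fiberHom_proj {V W : FGModuleCat.{u} (ActionAlgebra k H X)}
    (D : StabilizerGrading V) (D' : StabilizerGrading W) (f : V ⟶ W)
    (hf : ∀ (a : ActionAlgebra k H (Inertia H X)) (v : V),
      f.hom.hom (D.action a v) = D'.action a (f.hom.hom v)) (x : X) (h : H) (v : fiber V x) :
    fiberHom f x (D.proj x h v) = D'.proj x h (fiberHom f x v) := by
  by_cases hx : h • x = x
  -- On the fibre over `x`, the idempotent `δ_{(x, h)}` acts as the projection `p_h`.
  · have key := hf (single 1 (.of x h hx)) v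
    rw [action_single, action_single, ofGroup_one, one_smul, one_smul] at key
    refine Subtype.ext ?_
    change f.hom.hom (D.proj x h (fiberProj V x v.1)).1 =
      (D'.proj x h (fiberProj W x (fiberHom f x v).1)).1 at key
    rwa [fiberProj_coe, fiberProj_coe] at key
  · rw [D.proj_of_smul_ne hx, D'.proj_of_smul_ne hx]
    exact map_zero _

variable (k H X) in
/-- A half-braiding on a module over the action algebra of `X` extends the action to the action
algebra of the inertia set. -/
def centerToInertia : Center (FGModuleCat.{u} (ActionAlgebra k H X)) ⥤
    FGModuleCat.{u} (ActionAlgebra k H (Inertia H X)) where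
  obj A := FGModuleCat.of _ (grading A.2).Total
  map {A B} f := FGModuleCat.ofHom
    { toFun := f.f.hom.hom
      map_add' := map_add f.f.hom.hom
      map_smul' := (grading A.2).map_action (grading B.2) f.f
        ((center_comm_iff_proj f.f).1 f.comm) }

instance : (centerToInertia k H X).Additive where
  map_add := rfl

instance : (centerToInertia k H X).Linear k where
  map_smul {A B} f r := by
    ext v
    change algebraMap k (ActionAlgebra k H X) r • f.f.hom.hom v =
      (grading B.2).action (algebraMap k _ r) (f.f.hom.hom v)
    rw [AlgHom.commutes]
    rfl

/-! ### From modules over the inertia algebra to gradings -/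

variable (k H X) in
/-- The homomorphism of action algebras induced by the projection of the inertia set. -/
def inertiaMap : ActionAlgebra k H X →ₐ[k] ActionAlgebra k H (Inertia H X) :=
  comap k Inertia.base fun _ _ => rfl

open Classical in
theorem inertiaMap_single_apply (h g : H) (x : X) (ω : Inertia H X) :
    inertiaMap k H X (single h x) g ω = if g = h ∧ ω.base = x then 1 else 0 := rfl

open Classical in
theorem inertiaMap_single_one (x : X) :
    inertiaMap k H X (single 1 x) = ofFun fun ω => if ω.base = x then 1 else 0 := by
  rw [single_eq_ofFun]
  rfl

variable (k) in
open Classical in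
/-- The idempotent `δ_{(x, h)}`, which is zero if `h` does not fix `x`. -/
def loopIdempotent (x : X) (h : H) : ActionAlgebra k H (Inertia H X) :=
  ofFun fun ω => if ω.base = x ∧ ω.loop = h then 1 else 0

theorem loopIdempotent_eq_single (ω : Inertia H X) :
    loopIdempotent k ω.base ω.loop = single 1 ω := by
  classical
  rw [single_eq_ofFun, loopIdempotent]
  congr 1
  ext ω'
  exact if_congr (Inertia.ext_iff.symm) rfl rfl

theorem loopIdempotent_of_smul_ne {x : X} {h : H} (hx : h • x ≠ x) :
    loopIdempotent k x h = 0 := by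
  classical
  ext g ω
  have : ¬ (ω.base = x ∧ ω.loop = h) := by
    rintro ⟨rfl, rfl⟩
    exact hx ω.loop_smul
  simp [loopIdempotent, ofFun_apply, this]

/-- The image of `δ_x` is the indicator of all `ω` above `x`; hence `δ_{(x, h)}` maps into the fibre
over `x`. -/
theorem inertiaMap_mul_loopIdempotent (x : X) (h : H) :
    inertiaMap k H X (single 1 x) * loopIdempotent k x h = loopIdempotent k x h := by
  classical
  ext g ω
  rw [loopIdempotent, mul_ofFun, inertiaMap_single_apply, ofFun_apply]
  by_cases hω : ω.base = x <;> by_cases hl : ω.loop = h <;> simp [hω, hl]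

theorem loopIdempotent_mul_inertiaMap (x : X) (h : H) :
    loopIdempotent k x h * inertiaMap k H X (single 1 x) = loopIdempotent k x h := by
  classical
  ext g ω
  rw [inertiaMap_single_one, mul_ofFun, loopIdempotent, ofFun_apply]
  by_cases hω : ω.base = x <;> simp [hω]

/-- The action of `g` carries `(x, h)` to `(g x, g h g⁻¹)`; this yields the equivariance of the
grading. -/
theorem loopIdempotent_mul_inertiaMap_single {g : H} {x y : X} (hy : g • x = y) (h : H) :
    loopIdempotent k y (g * h * g⁻¹) * inertiaMap k H X (single g x) =
      inertiaMap k H X (single g x) * loopIdempotent k x h := by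
  classical
  subst hy
  ext l ω
  rw [loopIdempotent, loopIdempotent, ofFun_mul, mul_ofFun, inertiaMap_single_apply, mul_comm]
  by_cases e : l = g
  · simp [e]
  · simp [e]

open Classical in
theorem loopIdempotent_mul_loopIdempotent (x : X) (g h : H) :
    loopIdempotent k x g * loopIdempotent k x h = if g = h then loopIdempotent k x h else 0 := by
  ext l ω
  rw [loopIdempotent, loopIdempotent, mul_ofFun, ofFun_apply]
  by_cases e : g = h
  · subst e
    by_cases hω : ω.base = x ∧ ω.loop = g <;> simp [ofFun_apply, hω]
  · rw [if_neg e]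
    by_cases hω : ω.loop = h
    · simp [hω, Ne.symm e]
    · simp [hω]

theorem sum_loopIdempotent (x : X) :
    ∑ h, loopIdempotent k x h = inertiaMap k H X (single 1 x) := by
  classical
  ext g ω
  rw [sum_apply, inertiaMap_single_one, ofFun_apply]
  by_cases hω : ω.base = x <;> simp [loopIdempotent, ofFun_apply, hω]

section Restricted

variable (M : FGModuleCat.{u} (ActionAlgebra k H (Inertia H X)))

/-- A module over the action algebra of the inertia set as a module over the action algebra. -/
def Restricted : Type u := M

instance : AddCommGroup (Restricted M) := inferInstanceAs (AddCommGroup M)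

instance : Module (ActionAlgebra k H X) (Restricted M) :=
  Module.compHom M (inertiaMap k H X).toRingHom

instance : Module.Finite (ActionAlgebra k H X) (Restricted M) := by
  have : Module.Finite k M := finite_scalar M
  exact Module.Finite.of_surjective (σ := algebraMap k (ActionAlgebra k H X))
    ({ AddMonoidHom.id M with
      map_smul' := fun r m => by
        change algebraMap k (ActionAlgebra k H (Inertia H X)) r • m =
          inertiaMap k H X (algebraMap k _ r) • m
        rw [AlgHom.commutes] } : M →ₛₗ[_] Restricted M) Function.surjective_id

/-- The module over the action algebra of `X` that underlies a module over the action algebra of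
the inertia set. -/
def restricted : FGModuleCat.{u} (ActionAlgebra k H X) := FGModuleCat.of _ (Restricted M)

/-- The elements of the underlying module. -/
def ofRestricted : restricted M ≃+ M := AddEquiv.refl M

variable {M}

theorem ofRestricted_smul (a : ActionAlgebra k H X) (m : restricted M) :
    ofRestricted M (a • m) = inertiaMap k H X a • ofRestricted M m := rfl

theorem ofRestricted_scalar_smul (r : k) (m : restricted M) :
    ofRestricted M (r • m) = r • ofRestricted M m := by
  change inertiaMap k H X (algebraMap k _ r) • ofRestricted M m =
    algebraMap k (ActionAlgebra k H (Inertia H X)) r • ofRestricted M m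
  rw [AlgHom.commutes]

variable (M)

/-- The projection of a fibre to a component. -/
def restrictedProj (x : X) (h : H) : fiber (restricted M) x →ₗ[k] fiber (restricted M) x where
  toFun m := ⟨(ofRestricted M).symm (loopIdempotent k x h • ofRestricted M m.1), by
      apply (ofRestricted M).injective
      rw [ofRestricted_smul, AddEquiv.apply_symm_apply, smul_smul, inertiaMap_mul_loopIdempotent]⟩
  map_add' m m' := Subtype.ext <| (ofRestricted M).injective <| by
    simp
  map_smul' r m := Subtype.ext <| (ofRestricted M).injective <| by
    simp only [Submodule.coe_smul, ofRestricted_scalar_smul, AddEquiv.apply_symm_apply,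
      RingHom.id_apply, smul_comm_scalar]

theorem ofRestricted_restrictedProj (x : X) (h : H) (m : fiber (restricted M) x) :
    ofRestricted M (restrictedProj M x h m).1 = loopIdempotent k x h • ofRestricted M m.1 := rfl

theorem ofRestricted_fiberMap {x y : X} (g : H) (hy : g • x = y) (m : fiber (restricted M) x) :
    ofRestricted M (fiberMap (restricted M) g hy m).1 =
      inertiaMap k H X (single g x) • ofRestricted M m.1 := rfl

open Classical in
/-- The grading of the fibres of a module over the action algebra of the inertia set. -/
def restrictedGrading : StabilizerGrading (restricted M) where
  proj := restrictedProj M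
  proj_of_smul_ne hx := LinearMap.ext fun m => Subtype.ext <| (ofRestricted M).injective <| by
    rw [ofRestricted_restrictedProj, loopIdempotent_of_smul_ne hx, zero_smul]
    rfl
  proj_fiberMap {g x y} hy h m := Subtype.ext <| (ofRestricted M).injective <| by
    rw [ofRestricted_restrictedProj, ofRestricted_fiberMap, ofRestricted_fiberMap,
      ofRestricted_restrictedProj, smul_smul, smul_smul, loopIdempotent_mul_inertiaMap_single hy]
  proj_proj x g h m := Subtype.ext <| (ofRestricted M).injective <| by
    rw [ofRestricted_restrictedProj, ofRestricted_restrictedProj, smul_smul,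
      loopIdempotent_mul_loopIdempotent]
    split_ifs
    · rfl
    · exact zero_smul _ _
  sum_proj x m := Subtype.ext <| (ofRestricted M).injective <| by
    rw [Submodule.coe_sum, map_sum]
    simp only [ofRestricted_restrictedProj]
    rw [← Finset.sum_smul, sum_loopIdempotent, ← ofRestricted_smul, mem_fiber.1 m.2]

/-- Restricting a module and extending it again by its grading changes nothing. It is enough to
check `h ⊗ δ_ω`, the product of `h ⊗ 1` and `δ_ω`. -/
theorem restrictedGrading_action (a : ActionAlgebra k H (Inertia H X)) (m : restricted M) :
    ofRestricted M ((restrictedGrading M).action a m) = a • ofRestricted M m := by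
  have h1 (h : H) (ω : Inertia H X) :
      ofRestricted M ((restrictedGrading M).action (single h ω) m) =
        (single h ω : ActionAlgebra k H (Inertia H X)) • ofRestricted M m := by
    rw [StabilizerGrading.action_single, StabilizerGrading.component_apply, ofRestricted_smul]
    change ofGroup k (Inertia H X) h • loopIdempotent k ω.base ω.loop •
      inertiaMap k H X (single 1 ω.base) • ofRestricted M m = _
    rw [smul_smul (loopIdempotent k _ _), loopIdempotent_mul_inertiaMap, loopIdempotent_eq_single,
      smul_smul, ofGroup_mul_single, mul_one]
  conv_lhs => rw [eq_sum_single a]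
  conv_rhs => rw [eq_sum_single a]
  simp only [map_sum, map_smul, LinearMap.sum_apply, LinearMap.smul_apply, Finset.sum_smul,
    ofRestricted_scalar_smul, h1, smul_assoc]

end Restricted

/-- Underlying maps are unchanged, so the functor is faithful. It is full because linearity over the
inertia algebra gives both linearity over the action algebra of `X` and compatibility with the
projections. A module `M` comes from its restriction with the half-braiding of `restrictedGrading
M`. -/
instance : (centerToInertia k H X).IsEquivalence where
  faithful := ⟨fun {A B f g} h => Center.ext _ _ <| FGModuleCat.hom_ext <| LinearMap.ext fun v =>
    congrArg (fun f => f.hom.hom v) h⟩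
  full := ⟨fun {A B} f => by
    let g : A.1 ⟶ B.1 := FGModuleCat.ofHom (V := A.1) (W := B.1)
      { toFun := f.hom.hom
        map_add' := map_add f.hom.hom
        map_smul' := fun a v =>
          (congrArg f.hom.hom ((grading A.2).comap_smul a v).symm).trans
            ((f.hom.hom.map_smul (inertiaMap k H X a) v).trans ((grading B.2).comap_smul a _)) }
    have hg := (center_comm_iff_proj g).2
      ((grading A.2).fiberHom_proj (grading B.2) g fun a v => f.hom.hom.map_smul a v)
    exact ⟨{ f := g, comm := hg }, rfl⟩⟩
  essSurj := ⟨fun M => by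
    let A : Center (FGModuleCat.{u} (ActionAlgebra k H X)) :=
      ⟨restricted M, (restrictedGrading M).halfBraiding⟩
    have hA : grading A.2 = restrictedGrading M :=
      StabilizerGrading.ext (funext₂ (restrictedGrading M).proj_halfBraiding)
    let e : (grading A.2).Total ≃ₗ[ActionAlgebra k H (Inertia H X)] M :=
      { ofRestricted M with
        map_smul' := fun a m => by
          change ofRestricted M ((grading A.2).action a m) = a • ofRestricted M m
          rw [hA]
          exact restrictedGrading_action M a m }
    exact ⟨A, ⟨e.toFGModuleCatIso⟩⟩⟩

end ActionAlgebra

/-! ### The conjugation action and the theorem -/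

/-- The action algebra of the inertia set of the conjugation action is `D_{T²}(G)`. -/
def torusDoubleInertiaEquiv (k G : Type u) [Field k] [Group G] [Fintype G] :
    TorusDouble k G ≃ₐ[k] ActionAlgebra k (ConjAct G) (Inertia (ConjAct G) G) :=
  (torusDoubleEquiv k G).trans
    (ActionAlgebra.congr k (inertiaEquivCommutingPairs G) inertiaEquivCommutingPairs_smul)

/-- The functor from the center of the category of modules over the Drinfeld double to modules
over `D_{T²}(G)`. -/
def centerToTorus (k G : Type u) [Field k] [Group G] [Fintype G] :
    Center (FGModuleCat.{u} (DrinfeldDouble k G)) ⥤ FGModuleCat.{u} (TorusDouble k G) :=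
  ActionAlgebra.centerToInertia k (ConjAct G) G ⋙
    FGModuleCat.restrictScalarsEquiv (torusDoubleInertiaEquiv k G).toRingEquiv

instance (k G : Type u) [Field k] [Group G] [Fintype G] : (centerToTorus k G).IsEquivalence := by
  unfold centerToTorus; infer_instance

instance (k G : Type u) [Field k] [Group G] [Fintype G] : (centerToTorus k G).Additive := by
  unfold centerToTorus; infer_instance

instance (k G : Type u) [Field k] [Group G] [Fintype G] : (centerToTorus k G).Linear k := by
  unfold centerToTorus; infer_instance

/-- The functor from modules over `D_{T²}(G)` to bundles over the commuting pairs. -/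
def torusToBundle (k G : Type u) [Field k] [Group G] [Fintype G] :
    FGModuleCat.{u} (TorusDouble k G) ⥤ EquivariantBundle k (ConjAct G) (CommutingPairs G) :=
  FGModuleCat.restrictScalarsEquiv (torusDoubleEquiv k G).symm.toRingEquiv ⋙
    ActionAlgebra.toBundle k (ConjAct G) (CommutingPairs G)

instance (k G : Type u) [Field k] [Group G] [Fintype G] : (torusToBundle k G).IsEquivalence := by
  have : Fintype (CommutingPairs G) := Fintype.ofFinite _
  unfold torusToBundle; infer_instance

instance (k G : Type u) [Field k] [Group G] [Fintype G] : (torusToBundle k G).Additive := by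
  unfold torusToBundle; infer_instance

instance (k G : Type u) [Field k] [Group G] [Fintype G] : (torusToBundle k G).Linear k := by
  unfold torusToBundle; infer_instance

end

/-- For a finite group `G` and an algebraically closed field `k` of characteristic zero, the
Drinfeld center of `D(G)`-modules with the fibrewise tensor product is equivalent, as a `k`-linear
abelian category, to the modules over `D_{T²}(G)`, which are the `G`-equivariant bundles over the
set of commuting pairs. -/
theorem theoremt (k G : Type u) [Field k] [IsAlgClosed k] [CharZero k] [Group G] [Fintype G] :
    IsAbelianCategory (Center (FGModuleCat.{u} (DrinfeldDouble k G))) ∧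
    IsAbelianCategory (FGModuleCat.{u} (TorusDouble k G)) ∧
    (∃ F : Center (FGModuleCat.{u} (DrinfeldDouble k G)) ⥤ FGModuleCat.{u} (TorusDouble k G),
      F.IsEquivalence ∧ F.Additive ∧ F.Linear k) ∧
    (∃ E : FGModuleCat.{u} (TorusDouble k G) ⥤
        EquivariantBundle k (ConjAct G) (CommutingPairs G),
      E.IsEquivalence ∧ E.Additive ∧ E.Linear k) :=
  ⟨.of_isEquivalence (centerToTorus k G), ⟨inferInstance, rfl⟩,
    ⟨centerToTorus k G, inferInstance, inferInstance, inferInstance⟩,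
    ⟨torusToBundle k G, inferInstance, inferInstance, inferInstance⟩⟩
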